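/- Let $X_1, X_2, \dots$ be real random variables on a probability space $(\Omega,\mathcal F,\mathbf P)$ with $\mathbb E\{X_n\}=0$ and $\mathbb E\{X_n^2\}>0$ for all $n\ge 1$. Let $\sigma(n)^2$ be the variance of $X_1+\dots+X_n$, assume $\sigma(n)>0$ for all $n\ge1$, and put $S_n=(X_1+\dots+X_n)/\sigma(n)$. Let $\kappa:\{1,2,\dots\}\to\mathbb N$ be non-decreasing with $\kappa(1)=0$, $\kappa(n)\le n$ and $\kappa(n)/n\to0$. Put $u(1)=1$, $t(1)=0$ and, for $n\ge2$, $u(n)=\max\{m\ge1 : 2m+\kappa(m)\le n\}$ and $t(n)=n-2u(n)$. Writing $u=u(n)$ and $t=t(n)$, set $$S_u=\frac{X_1+\dots+X_u}{\sigma(u)},\qquad \xi_u=\frac{X_{u+1}+\dots+X_{u+t}}{\sigma(u)},\qquad S'_u=\frac{X_{u+t+1}+\dots+X_{u+t+u}}{\sigma(u)}$$ (so $\xi_u=0$ if $t=0$). All limits are taken as $n\to\infty$. Perturbations $\varepsilon_n,\varepsilon'_n$ below are random variables on the same probability space, one pair for each $n$. Assume: 1. $\mathbb E\{|X_n|^4\}<\infty$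 for all $n\ge1$, and $\mathbb E\{\xi_{u}^4\}\to0$. 2. ($H_S$ and $H_I$) There are square integrable $\varepsilon_n,\varepsilon'_n$ with $\mathbb E\{\varepsilon_n\}=\mathbb E\{\varepsilon'_n\}=0$ and $\mathbb E\{\varepsilon_n^2\}+\mathbb E\{\varepsilon_n'^2\}\to0$ such that, with $\sigma^*_n=\mathbb E\{(S_u+\varepsilon_n)^2\}^{1/2}$ and the events $$A_{k,j}=\Big\{\tfrac{S_u+\varepsilon_n}{\sigma^*_n}\in[4^{-k}j,4^{-k}(j+1))\Big\},\qquad B_{k,j}=\Big\{\tfrac{S'_u+\varepsilon'_n}{\sigma^*_n}\in[4^{-k}j,4^{-k}(j+1))\Big\},$$ one has, for all $k\in\mathbb N$ and all $j,j'\in\mathbb Z$, $$H_S:\ \mathbf P\{A_{k,j}\}-\mathbf P\{B_{k,j}\}\to0,\qquad H_I:\ \mathbf P\{A_{k,j}\cap B_{k,j'}\}-\mathbf P\{A_{k,j}\}\mathbf P\{B_{k,j'}\}\to0.$$ 3. ($H_{mS}(4)$ and $H_{mI}(4)$) There are $\delta_n,\delta'_n$ (possibly different from $\varepsilon_n,\varepsilon_n'$)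 with finite fourth moments and $\mathbb E\{\delta_n^p\}+\mathbb E\{\delta_n'^p\}\to0$ for $p=1,2,3,4$, such that $$H_{mS}(4):\ \mathbb E\{(S_u+\delta_n)^p\}-\mathbb E\{(S'_u+\delta'_n)^p\}\to0\quad\text{for all integers } 0\le p\le4,$$ $$H_{mI}(4):\ \mathbb E\{(S_u+\delta_n)^p(S'_u+\delta'_n)^q\}-\mathbb E\{(S_u+\delta_n)^p\}\,\mathbb E\{(S'_u+\delta'_n)^q\}\to0\quad\text{for all integers } p,q\ge1,\ p+q\le4.$$ Then $S_n\xrightarrow{d}N(0,1)$. Moreover, $\mathbb E\{S_n^3\}\to0$ and $\mathbb E\{S_n^4\}\to3$. -/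

import Mathlib

open MeasureTheory ProbabilityTheory Filter
open scoped Topology ENNReal

namespace BlockCLT

/-- The half-block length: `u(1) = 1` and `u(n) = max {m ≥ 1 : 2 m + κ(m) ≤ n}` for `n ≥ 2`. -/
noncomputable def halfLen (κ : ℕ → ℕ) (n : ℕ) : ℕ :=
  if n ≤ 1 then 1 else sSup {m : ℕ | 1 ≤ m ∧ 2 * m + κ m ≤ n}

/-- The gap length: `t(1) = 0` and `t(n) = n - 2 u(n)` for `n ≥ 2`
(for `n ≥ 2` the subtraction is exact, since `2 u(n) ≤ n`). -/
noncomputable def gapLen (κ : ℕ → ℕ) (n : ℕ) : ℕ :=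
  n - 2 * halfLen κ n

/-- The standing conditions on the gap sequence `κ(n)`, `n ≥ 1`: it is non-decreasing,
`κ(1) = 0`, `κ(n) ≤ n` and `κ(n) / n → 0`. -/
structure IsGapSequence (κ : ℕ → ℕ) : Prop where
  mono : ∀ m n, 1 ≤ m → m ≤ n → κ m ≤ κ n
  one : κ 1 = 0
  le : ∀ n, 1 ≤ n → κ n ≤ n
  tendsto : Tendsto (fun n : ℕ => (κ n : ℝ) / (n : ℝ)) atTop (𝓝 0)

section

variable {Ω : Type*} [MeasurableSpace Ω]

/-- `σ(n)`, the standard deviation of `X_1 + ⋯ + X_n`. -/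
noncomputable def sigma (P : Measure Ω) (X : ℕ → Ω → ℝ) (n : ℕ) : ℝ :=
  √(Var[fun ω => ∑ i ∈ Finset.Icc 1 n, X i ω; P])

/-- The normalized sum `S_n = (X_1 + ⋯ + X_n) / σ(n)`. -/
noncomputable def normSum (P : Measure Ω) (X : ℕ → Ω → ℝ) (n : ℕ) (ω : Ω) : ℝ :=
  (∑ i ∈ Finset.Icc 1 n, X i ω) / sigma P X n

/-- The first block `S_u = (X_1 + ⋯ + X_u) / σ(u)`, with `u = u(n)`. -/
noncomputable def firstBlock (P : Measure Ω) (X : ℕ → Ω → ℝ) (κ : ℕ → ℕ) (n : ℕ) (ω : Ω) : ℝ :=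
  normSum P X (halfLen κ n) ω

/-- The middle block (remainder) `ξ_u = (X_{u+1} + ⋯ + X_{u+t}) / σ(u)`, with `u = u(n)` and
`t = t(n)`; it is `0` when `t(n) = 0`. -/
noncomputable def middleBlock (P : Measure Ω) (X : ℕ → Ω → ℝ) (κ : ℕ → ℕ) (n : ℕ) (ω : Ω) : ℝ :=
  (∑ i ∈ Finset.Ioc (halfLen κ n) (halfLen κ n + gapLen κ n), X i ω) / sigma P X (halfLen κ n)

/-- The last block `S'_u = (X_{u+t+1} + ⋯ + X_{u+t+u}) / σ(u)`, with `u = u(n)` and `t = t(n)`. -/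
noncomputable def lastBlock (P : Measure Ω) (X : ℕ → Ω → ℝ) (κ : ℕ → ℕ) (n : ℕ) (ω : Ω) : ℝ :=
  (∑ i ∈ Finset.Ioc (halfLen κ n + gapLen κ n) (halfLen κ n + gapLen κ n + halfLen κ n), X i ω) /
    sigma P X (halfLen κ n)

/-- `σ*(u) = (E{(S_u + ε_u)²})^{1/2}`, with `u = u(n)`. -/
noncomputable def sigmaStar (P : Measure Ω) (X : ℕ → Ω → ℝ) (κ : ℕ → ℕ) (ε : ℕ → Ω → ℝ)
    (n : ℕ) : ℝ :=
  √(∫ ω, (firstBlock P X κ n ω + ε n ω) ^ 2 ∂P)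

/-- The cell `[4^{-k} j, 4^{-k} (j+1))`. For fixed `k`, these cells form a partition of `ℝ`
when `j` runs over `ℤ`. -/
def cell (k : ℕ) (j : ℤ) : Set ℝ :=
  Set.Ico ((j : ℝ) / 4 ^ k) (((j : ℝ) + 1) / 4 ^ k)

/-- The event `A_{k,j} = {σ*(u)⁻¹ (S_u + ε_u) ∈ [4^{-k} j, 4^{-k} (j+1))}`, with `u = u(n)`. -/
noncomputable def eventA (P : Measure Ω) (X : ℕ → Ω → ℝ) (κ : ℕ → ℕ) (ε : ℕ → Ω → ℝ)
    (n k : ℕ) (j : ℤ) : Set Ω :=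
  {ω | (sigmaStar P X κ ε n)⁻¹ * (firstBlock P X κ n ω + ε n ω) ∈ cell k j}

/-- The event `B_{k,j} = {σ*(u)⁻¹ (S'_u + ε'_u) ∈ [4^{-k} j, 4^{-k} (j+1))}`, with `u = u(n)`. -/
noncomputable def eventB (P : Measure Ω) (X : ℕ → Ω → ℝ) (κ : ℕ → ℕ) (ε ε' : ℕ → Ω → ℝ)
    (n k : ℕ) (j : ℤ) : Set Ω :=
  {ω | (sigmaStar P X κ ε n)⁻¹ * (lastBlock P X κ n ω + ε' n ω) ∈ cell k j}

/-- The pairs of perturbations allowed in `H_S` and `H_I`: centred, square integrable, with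
`E{ε²} + E{ε'²} → 0`. -/
structure IsL2Perturbation (P : Measure Ω) (ε ε' : ℕ → Ω → ℝ) : Prop where
  memLp : ∀ n, MemLp (ε n) 2 P
  memLp' : ∀ n, MemLp (ε' n) 2 P
  mean : ∀ n, ∫ ω, ε n ω ∂P = 0
  mean' : ∀ n, ∫ ω, ε' n ω ∂P = 0
  tendsto : Tendsto (fun n => (∫ ω, ε n ω ^ 2 ∂P) + ∫ ω, ε' n ω ^ 2 ∂P) atTop (𝓝 0)

/-- Condition `H_S` for the perturbations `ε, ε'`. -/
def HS (P : Measure Ω) (X : ℕ → Ω → ℝ) (κ : ℕ → ℕ) (ε ε' : ℕ → Ω → ℝ) : Prop :=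
  ∀ (k : ℕ) (j : ℤ),
    Tendsto (fun n => P.real (eventA P X κ ε n k j) - P.real (eventB P X κ ε ε' n k j))
      atTop (𝓝 0)

/-- Condition `H_I` for the perturbations `ε, ε'`. -/
def HI (P : Measure Ω) (X : ℕ → Ω → ℝ) (κ : ℕ → ℕ) (ε ε' : ℕ → Ω → ℝ) : Prop :=
  ∀ (k : ℕ) (j j' : ℤ),
    Tendsto (fun n => P.real (eventA P X κ ε n k j ∩ eventB P X κ ε ε' n k j') -
      P.real (eventA P X κ ε n k j) * P.real (eventB P X κ ε ε' n k j')) atTop (𝓝 0)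

/-- The pairs of perturbations allowed in `H_mS(m)` and `H_mI(m)`: finite `m`-th moments, and
`E{ε^p} + E{ε'^p} → 0` for `1 ≤ p < m + 1`. -/
structure IsMomentPerturbation (P : Measure Ω) (m : ℕ) (ε ε' : ℕ → Ω → ℝ) : Prop where
  memLp : ∀ n, MemLp (ε n) (m : ℝ≥0∞) P
  memLp' : ∀ n, MemLp (ε' n) (m : ℝ≥0∞) P
  tendsto : ∀ p : ℕ, 1 ≤ p → p < m + 1 →
    Tendsto (fun n => (∫ ω, ε n ω ^ p ∂P) + ∫ ω, ε' n ω ^ p ∂P) atTop (𝓝 0)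

/-- Condition `H_mS(m)` for the perturbations `ε, ε'`. -/
def HmS (P : Measure Ω) (X : ℕ → Ω → ℝ) (κ : ℕ → ℕ) (m : ℕ) (ε ε' : ℕ → Ω → ℝ) : Prop :=
  ∀ p : ℕ, p < m + 1 →
    Tendsto (fun n => (∫ ω, (firstBlock P X κ n ω + ε n ω) ^ p ∂P) -
      ∫ ω, (lastBlock P X κ n ω + ε' n ω) ^ p ∂P) atTop (𝓝 0)

/-- Condition `H_mI(m)` for the perturbations `ε, ε'`. -/
def HmI (P : Measure Ω) (X : ℕ → Ω → ℝ) (κ : ℕ → ℕ) (m : ℕ) (ε ε' : ℕ → Ω → ℝ) : Prop :=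
  ∀ p q : ℕ, 1 ≤ p → 1 ≤ q → p + q < m + 1 →
    Tendsto (fun n =>
      (∫ ω, (firstBlock P X κ n ω + ε n ω) ^ p * (lastBlock P X κ n ω + ε' n ω) ^ q ∂P) -
        (∫ ω, (firstBlock P X κ n ω + ε n ω) ^ p ∂P) *
          ∫ ω, (lastBlock P X κ n ω + ε' n ω) ^ q ∂P) atTop (𝓝 0)

end

end BlockCLT

/-! ### Elementary inequalities and contracting recursions -/

namespace BlockCLT

/-! For `n ≥ 2` the sum splits exactly as `S_n = r_n (S_u + ξ_u + S'_u)` with `r_n = σ(u) / σ(n)`.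
Up to errors that vanish in `L⁴` or `L²`, this presents `S_n` as a normalized sum of two
asymptotically independent copies of `S_u`, and `N(0,1)` is the fixed point of that operation.

Moments: the perturbed blocks have means tending to `0` and second moments tending to `1`, so the
square of their sum has mean tending to `2`. As `E S_n² = 1`, this forces `r_n → 1/√2`. Expanding
powers gives `E S_n⁴ ≈ (2 E S_u⁴ + 6) / 4` and `E S_n³ ≈ E S_u³ / √2`: contractions with fixed
points `3` and `0`. Since `u(n) → ∞`, a bounded solution of such an asymptotic recursion converges
to the fixed point (`tendsto_zero_of_recursion`). Boundedness of the fourth moments comes first,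
from a cruder inequality with factor below `1` and strong induction along `u(n) < n`.

Law: the cell conditions give `φ_n(t) ≈ φ_u(t/√2)²` (`tendsto_integral_exp_sub_sq_of_cells`), an
equation that the Gaussian characteristic function `g` satisfies exactly. Iterating `k` times
multiplies an error by `2^k`, but moves the argument to `t / √2^k`. There, `|φ - g|` is at most `C
|t|³ 2^(-3k/2)`, because the first two moments agree and the fourth moments are bounded. The total
`C |t|³ 2^(-k/2)` is small for large `k`; `n → ∞` is taken with `k` fixed
(`tendsto_integral_exp_of_recursion`). -/

lemma abs_pow_four (a : ℝ) : |a| ^ 4 = a ^ 4 := by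
  rw [← abs_pow, abs_of_nonneg (by positivity)]

lemma one_add_abs_pow_four_le (a : ℝ) : (1 + |a|) ^ 4 ≤ 8 * (1 + a ^ 4) := by
  rw [← abs_pow_four a]
  have h0 := abs_nonneg a
  nlinarith [sq_nonneg (|a| - 1), sq_nonneg (|a| ^ 2 - 1), mul_nonneg h0 (sq_nonneg (|a| - 1)),
    mul_nonneg (pow_nonneg h0 2) (sq_nonneg (|a| - 1))]

/-- Powers up to the fourth are stable under small perturbations. -/
lemma exists_abs_add_pow_sub_pow_le {τ : ℝ} (hτ : 0 < τ) :
    ∃ C : ℝ, 0 ≤ C ∧ ∀ p ≤ 4, ∀ a b : ℝ,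
      |(a + b) ^ p - a ^ p| ≤ τ * (1 + a ^ 4) + C * b ^ 4 := by
  -- Cases are split at `|b| = θ (1 + |a|)`. Below, the mean value bound costs `4 * 2 ^ 3 = 32` and
  -- `one_add_abs_pow_four_le` another `8`, whence `256 θ ≤ τ`. Above, `1 + |a|` and `|b|` are at
  -- most `D = |b| / θ`, and `(2 D) ^ 4 + D ^ 4 = 17 D ^ 4`.
  obtain ⟨θ, hθ, hθ1, hθτ⟩ : ∃ θ : ℝ, 0 < θ ∧ θ ≤ 1 ∧ 256 * θ ≤ τ :=
    ⟨min 1 (τ / 256), by positivity, min_le_left _ _, by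
      have := min_le_right 1 (τ / 256); linarith⟩
  refine ⟨17 / θ ^ 4, by positivity, fun p hp a b => ?_⟩
  have ha := abs_nonneg a
  have hab := abs_add_le a b
  have h4 : (0 : ℝ) ≤ a ^ 4 := by positivity
  have hbb : (0 : ℝ) ≤ b ^ 4 := by positivity
  rcases le_or_gt |b| (θ * (1 + |a|)) with h | h
  · have hb1 : |b| ≤ 1 + |a| := h.trans (by nlinarith)
    have hmax : max |a + b| |a| ≤ 2 * (1 + |a|) := max_le (by linarith) (by linarith)
    have hle : |(a + b) ^ p - a ^ p| ≤ 32 * θ * (1 + |a|) ^ 4 := by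
      calc |(a + b) ^ p - a ^ p| ≤ |a + b - a| * p * max |a + b| |a| ^ (p - 1) :=
            abs_pow_sub_pow_le _ _ _
        _ ≤ (θ * (1 + |a|)) * 4 * (2 * (1 + |a|)) ^ 3 := by
            have hp' : (p : ℝ) ≤ 4 := by exact_mod_cast hp
            have h1 : max |a + b| |a| ^ (p - 1) ≤ (2 * (1 + |a|)) ^ 3 :=
              (pow_le_pow_left₀ (by positivity) hmax _).trans
                (pow_le_pow_right₀ (by linarith) (by omega))
            rw [add_sub_cancel_left]
            gcongr
        _ = _ := by ring
    have := one_add_abs_pow_four_le a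
    calc _ ≤ 32 * θ * (8 * (1 + a ^ 4)) := hle.trans (by gcongr)
      _ = 256 * θ * (1 + a ^ 4) := by ring
      _ ≤ τ * (1 + a ^ 4) := by gcongr
      _ ≤ _ := le_add_of_nonneg_right (by positivity)
  · set D := |b| / θ with hD
    have hDa : 1 + |a| < D := by rw [hD, lt_div_iff₀ hθ]; linarith
    have hbD : |b| ≤ D := by
      rw [hD, le_div_iff₀ hθ]; nlinarith [abs_nonneg b]
    have h1 : |(a + b) ^ p| ≤ (2 * D) ^ 4 := by
      rw [abs_pow]
      exact (pow_le_pow_left₀ (by positivity) (by linarith : |a + b| ≤ 2 * D) _).trans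
        (pow_le_pow_right₀ (by linarith) hp)
    have h2 : |a ^ p| ≤ D ^ 4 := by
      rw [abs_pow]
      exact (pow_le_pow_left₀ (by positivity) (by linarith : |a| ≤ D) _).trans
        (pow_le_pow_right₀ (by linarith) hp)
    have h3 : 17 / θ ^ 4 * b ^ 4 = 17 * D ^ 4 := by
      rw [← abs_pow_four b, hD, div_pow]; ring
    rw [h3]
    have := abs_sub ((a + b) ^ p) (a ^ p)
    have : (0 : ℝ) ≤ τ * (1 + a ^ 4) := by positivity
    nlinarith

/-- If `|x|` is bounded by `τ B + C w`, with `B` bounded, `w → 0` and `τ` arbitrary, then `x → 0`. -/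
lemma tendsto_zero_of_forall_le {ι : Type*} {l : Filter ι} {x B w : ι → ℝ} {K : ℝ}
    (h : ∀ τ : ℝ, 0 < τ → ∃ C : ℝ, ∀ᶠ n in l, |x n| ≤ τ * B n + C * w n)
    (hB : ∀ᶠ n in l, B n ≤ K) (hw : Tendsto w l (𝓝 0)) : Tendsto x l (𝓝 0) := by
  rw [Metric.tendsto_nhds]
  intro η hη
  obtain ⟨C, hC⟩ := h (η / (2 * (|K| + 1))) (by positivity)
  have hCw : Tendsto (fun n => C * w n) l (𝓝 0) := by simpa using hw.const_mul C
  filter_upwards [hC, hB, hCw.eventually_lt_const (half_pos hη)] with n h1 h2 h3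
  rw [Real.dist_eq, sub_zero]
  have : η / (2 * (|K| + 1)) * B n ≤ η / 2 := by
    calc _ ≤ η / (2 * (|K| + 1)) * (|K| + 1) := by
          gcongr; linarith [le_abs_self K]
      _ = η / 2 := by field_simp
  linarith

/-- A bounded sequence with `x n - c x (u n) → 0`, `|c| < 1`, tends to zero. -/
lemma tendsto_zero_of_recursion {x : ℕ → ℝ} {u : ℕ → ℕ} {c B : ℝ} (hu : Tendsto u atTop atTop)
    (hc : |c| < 1) (hB : ∀ n, |x n| ≤ B)
    (h : Tendsto (fun n => x n - c * x (u n)) atTop (𝓝 0)) : Tendsto x atTop (𝓝 0) := by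
  -- With `k` fixed, each use of the recursion gains a factor `|c|` at the cost of an error that is
  -- eventually small; `k` is chosen only after that.
  have key : ∀ k : ℕ, ∀ η : ℝ, 0 < η → ∀ᶠ n in atTop, |x n| ≤ |c| ^ k * B + η := by
    intro k
    induction k with
    | zero =>
      intro η hη
      exact Eventually.of_forall fun n => by simpa using (hB n).trans (by linarith)
    | succ k ih =>
      intro η hη
      filter_upwards [hu.eventually (ih (η / 2) (half_pos hη)),
        (Metric.tendsto_nhds.1 h) (η / 2) (half_pos hη)] with n h1 h2
      rw [Real.dist_eq, sub_zero] at h2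
      have h3 : |x n| ≤ |x n - c * x (u n)| + |c| * |x (u n)| := by
        rw [← abs_mul]; simpa using abs_add_le (x n - c * x (u n)) (c * x (u n))
      have h4 : |c| * |x (u n)| ≤ |c| * (|c| ^ k * B + η / 2) := by gcongr
      have h5 : |c| * (η / 2) ≤ η / 2 := by nlinarith
      rw [pow_succ]
      nlinarith
  rw [Metric.tendsto_nhds]
  intro η hη
  have hp : Tendsto (fun k : ℕ => |c| ^ k * B) atTop (𝓝 0) := by
    simpa using (tendsto_pow_atTop_nhds_zero_of_lt_one (abs_nonneg c) hc).mul_const B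
  obtain ⟨k, hk⟩ := (hp.eventually_lt_const (half_pos hη)).exists
  filter_upwards [key k (η / 2) (half_pos hη)] with n hn
  rw [Real.dist_eq, sub_zero]
  linarith

/-- A sequence with `a n ≤ c a (u n) + K` eventually, `c < 1` and `u n < n`, is bounded above. -/
lemma exists_forall_le_of_recursion {a : ℕ → ℝ} {u : ℕ → ℕ} {c K : ℝ} (hc0 : 0 ≤ c) (hc : c < 1)
    (hu : ∀ᶠ n in atTop, u n < n) (h : ∀ᶠ n in atTop, a n ≤ c * a (u n) + K) :
    ∃ B, ∀ n, a n ≤ B := by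
  obtain ⟨N, hN⟩ := eventually_atTop.1 (hu.and h)
  obtain ⟨M, hM⟩ := ((Set.finite_Iio N).image a).bddAbove
  -- `K / (1 - c)` is the fixed point of `b ↦ c b + K`, so any bound above it survives the induction
  -- step.
  refine ⟨max M (K / (1 - c)), fun n => ?_⟩
  induction n using Nat.strong_induction_on with
  | _ n ih =>
    rcases lt_or_ge n N with hn | hn
    · exact (hM (Set.mem_image_of_mem a hn)).trans (le_max_left _ _)
    · obtain ⟨h1, h2⟩ := hN n hn
      have h3 := ih (u n) h1
      have h4 : K ≤ (1 - c) * max M (K / (1 - c)) := by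
        have := le_max_right M (K / (1 - c))
        rwa [div_le_iff₀' (by linarith)] at this
      nlinarith

/-! ### Moments under small perturbations -/

section

variable {Ω : Type*} [MeasurableSpace Ω] {P : Measure Ω} [IsProbabilityMeasure P]

/-- With `m = max 1 (max |f| |g|)` the product is at most `m ^ (p + q) ≤ m ^ 4 ≤ 1 + f ^ 4 + g ^ 4`,
one domination for all exponents. -/
lemma integrable_pow_mul_pow {f g : Ω → ℝ} (hf : MemLp f 4 P) (hg : MemLp g 4 P) {p q : ℕ}
    (hpq : p + q ≤ 4) : Integrable (fun ω => f ω ^ p * g ω ^ q) P := by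
  have hf4 : Integrable (fun ω => f ω ^ 4) P := by
    simpa [abs_pow_four] using hf.integrable_norm_pow (p := 4) (by norm_num)
  have hg4 : Integrable (fun ω => g ω ^ 4) P := by
    simpa [abs_pow_four] using hg.integrable_norm_pow (p := 4) (by norm_num)
  refine Integrable.mono' ((integrable_const (1 : ℝ)).add (hf4.add hg4))
    ((hf.1.pow p).mul (hg.1.pow q)) (Eventually.of_forall fun ω => ?_)
  simp only [Pi.add_apply, norm_mul, norm_pow, Real.norm_eq_abs, ← abs_pow_four (f ω),
    ← abs_pow_four (g ω)]
  set m := max 1 (max |f ω| |g ω|) with hmdef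
  have h1 : |f ω| ^ p * |g ω| ^ q ≤ m ^ 4 := by
    calc _ ≤ m ^ p * m ^ q := by
          gcongr
          · exact (le_max_left _ _).trans (le_max_right _ _)
          · exact (le_max_right _ _).trans (le_max_right _ _)
      _ = m ^ (p + q) := (pow_add _ _ _).symm
      _ ≤ _ := pow_le_pow_right₀ (le_max_left _ _) hpq
  refine h1.trans ?_
  have hf0 : 0 ≤ |f ω| ^ 4 := by positivity
  have hg0 : 0 ≤ |g ω| ^ 4 := by positivity
  rcases max_choice 1 (max |f ω| |g ω|) with h | h
  · rw [hmdef, h]; linarith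
  · rw [hmdef, h]
    rcases max_choice |f ω| |g ω| with h' | h' <;> rw [h'] <;> linarith

lemma integrable_pow_of_memLp {f : Ω → ℝ} (hf : MemLp f 4 P) {p : ℕ} (hp : p ≤ 4) :
    Integrable (fun ω => f ω ^ p) P := by
  simpa using integrable_pow_mul_pow hf hf (p := p) (q := 0) (by omega)

/-- From `|x| ^ 3 ≤ 1 + x ^ 4`. A bound linear in the fourth moment can be absorbed in the fourth
moment recursion. -/
lemma abs_integral_pow_three_le {f : Ω → ℝ} (hf : MemLp f 4 P) :
    |∫ ω, f ω ^ 3 ∂P| ≤ 1 + ∫ ω, f ω ^ 4 ∂P := by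
  have h4 := integrable_pow_of_memLp hf (p := 4) le_rfl
  calc |∫ ω, f ω ^ 3 ∂P| ≤ ∫ ω, |f ω ^ 3| ∂P := abs_integral_le_integral_abs
    _ ≤ ∫ ω, (1 + f ω ^ 4) ∂P := by
      refine integral_mono (integrable_pow_of_memLp hf (by norm_num)).abs
        ((integrable_const _).add h4) fun ω => ?_
      change |f ω ^ 3| ≤ 1 + f ω ^ 4
      rw [abs_le]
      constructor <;> nlinarith [sq_nonneg (f ω ^ 2 - f ω), sq_nonneg (f ω ^ 2 + f ω),
        sq_nonneg (f ω ^ 2 - 1), sq_nonneg (f ω)]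
    _ = _ := by rw [integral_add (integrable_const _) h4]; simp

/-- `C` depends on `τ` only, which gives uniformity along a sequence; linearity in the fourth moment
of `U` allows its use before these moments are known to be bounded. -/
lemma exists_abs_integral_add_pow_sub_le {τ : ℝ} (hτ : 0 < τ) :
    ∃ C : ℝ, 0 ≤ C ∧ ∀ p ≤ 4, ∀ U W : Ω → ℝ, MemLp U 4 P → MemLp W 4 P →
      |(∫ ω, (U ω + W ω) ^ p ∂P) - ∫ ω, U ω ^ p ∂P| ≤
        τ * (1 + ∫ ω, U ω ^ 4 ∂P) + C * ∫ ω, W ω ^ 4 ∂P := by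
  obtain ⟨C, hC, h⟩ := exists_abs_add_pow_sub_pow_le hτ
  refine ⟨C, hC, fun p hp U W hU hW => ?_⟩
  have hU4 := integrable_pow_of_memLp hU (p := 4) le_rfl
  have hW4 := integrable_pow_of_memLp hW (p := 4) le_rfl
  have hUW : Integrable (fun ω => (U ω + W ω) ^ p) P := integrable_pow_of_memLp (hU.add hW) hp
  have hUp := integrable_pow_of_memLp hU hp
  have hint : Integrable (fun ω => τ * (1 + U ω ^ 4)) P :=
    ((integrable_const _).add hU4).const_mul τ
  rw [← integral_sub hUW hUp]
  calc |∫ ω, ((U ω + W ω) ^ p - U ω ^ p) ∂P| ≤ ∫ ω, |(U ω + W ω) ^ p - U ω ^ p| ∂P :=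
        abs_integral_le_integral_abs
    _ ≤ ∫ ω, (τ * (1 + U ω ^ 4) + C * W ω ^ 4) ∂P :=
        integral_mono (hUW.sub hUp).abs (hint.add (hW4.const_mul C)) fun ω => h p hp _ _
    _ = _ := by
        rw [integral_add hint (hW4.const_mul C), integral_const_mul, integral_const_mul,
          integral_add (integrable_const _) hU4]
        simp

variable {ι : Type*} {l : Filter ι}

lemma tendsto_integral_add_pow_sub {U W : ι → Ω → ℝ} {K : ℝ} {p : ℕ} (hp : p ≤ 4)
    (hU : ∀ n, MemLp (U n) 4 P) (hW : ∀ n, MemLp (W n) 4 P)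
    (hK : ∀ᶠ n in l, ∫ ω, U n ω ^ 4 ∂P ≤ K)
    (h : Tendsto (fun n => ∫ ω, W n ω ^ 4 ∂P) l (𝓝 0)) :
    Tendsto (fun n => (∫ ω, (U n ω + W n ω) ^ p ∂P) - ∫ ω, U n ω ^ p ∂P) l (𝓝 0) := by
  refine tendsto_zero_of_forall_le (B := fun n => 1 + ∫ ω, U n ω ^ 4 ∂P) (K := 1 + K)
    (fun τ hτ => ?_) (hK.mono fun n hn => by linarith) h
  obtain ⟨C, -, hC⟩ := exists_abs_integral_add_pow_sub_le (P := P) hτ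
  exact ⟨C, Eventually.of_forall fun n => hC p hp _ _ (hU n) (hW n)⟩

lemma tendsto_integral_pow_of_four {W : ι → Ω → ℝ} {p : ℕ} (hp0 : 1 ≤ p) (hp : p ≤ 4)
    (hW : ∀ n, MemLp (W n) 4 P) (h : Tendsto (fun n => ∫ ω, W n ω ^ 4 ∂P) l (𝓝 0)) :
    Tendsto (fun n => ∫ ω, W n ω ^ p ∂P) l (𝓝 0) := by
  have := tendsto_integral_add_pow_sub (P := P) (U := fun _ _ => 0) (K := 0) hp
    (fun _ => MemLp.zero') hW (by simp) h
  simpa [show p ≠ 0 by omega] using this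

lemma tendsto_integral_add_pow_four {U W : ι → Ω → ℝ}
    (hU : ∀ n, MemLp (U n) 4 P) (hW : ∀ n, MemLp (W n) 4 P)
    (hU0 : Tendsto (fun n => ∫ ω, U n ω ^ 4 ∂P) l (𝓝 0))
    (hW0 : Tendsto (fun n => ∫ ω, W n ω ^ 4 ∂P) l (𝓝 0)) :
    Tendsto (fun n => ∫ ω, (U n ω + W n ω) ^ 4 ∂P) l (𝓝 0) := by
  have := (tendsto_integral_add_pow_sub (P := P) (K := 1) le_rfl hU hW
    ((hU0.eventually_lt_const one_pos).mono fun n hn => hn.le) hW0).add hU0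
  simpa using this

omit [IsProbabilityMeasure P] in
/-- Second moments are stable under `L²` perturbations. -/
lemma tendsto_integral_add_sq_sub {U W : ι → Ω → ℝ} {K : ℝ}
    (hU : ∀ n, MemLp (U n) 2 P) (hW : ∀ n, MemLp (W n) 2 P)
    (hK : ∀ᶠ n in l, ∫ ω, U n ω ^ 2 ∂P ≤ K)
    (h : Tendsto (fun n => ∫ ω, W n ω ^ 2 ∂P) l (𝓝 0)) :
    Tendsto (fun n => (∫ ω, (U n ω + W n ω) ^ 2 ∂P) - ∫ ω, U n ω ^ 2 ∂P) l (𝓝 0) := by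
  refine tendsto_zero_of_forall_le (B := fun n => ∫ ω, U n ω ^ 2 ∂P) (fun τ hτ => ?_) hK h
  -- Young's inequality `2 |U W| ≤ τ U ^ 2 + W ^ 2 / τ`, plus one more `W ^ 2`.
  refine ⟨1 / τ + 1, Eventually.of_forall fun n => ?_⟩
  have hU2 := (hU n).integrable_sq
  have hW2 := (hW n).integrable_sq
  have hUW : Integrable (fun ω => (U n ω + W n ω) ^ 2) P := ((hU n).add (hW n)).integrable_sq
  rw [← integral_sub hUW hU2]
  calc _ ≤ ∫ ω, |(U n ω + W n ω) ^ 2 - U n ω ^ 2| ∂P := abs_integral_le_integral_abs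
    _ ≤ ∫ ω, (τ * U n ω ^ 2 + (1 / τ + 1) * W n ω ^ 2) ∂P := by
        refine integral_mono (hUW.sub hU2).abs ((hU2.const_mul _).add (hW2.const_mul _))
          fun ω => ?_
        change |(U n ω + W n ω) ^ 2 - U n ω ^ 2| ≤ τ * U n ω ^ 2 + (1 / τ + 1) * W n ω ^ 2
        have h1 : τ * U n ω ^ 2 + (1 / τ + 1) * W n ω ^ 2 - W n ω ^ 2 - 2 * U n ω * W n ω
            = (τ * U n ω - W n ω) ^ 2 / τ := by field_simp; ring
        have h2 : τ * U n ω ^ 2 + (1 / τ + 1) * W n ω ^ 2 - W n ω ^ 2 + 2 * U n ω * W n ω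
            = (τ * U n ω + W n ω) ^ 2 / τ := by field_simp; ring
        have h3 : 0 ≤ (τ * U n ω - W n ω) ^ 2 / τ := by positivity
        have h4 : 0 ≤ (τ * U n ω + W n ω) ^ 2 / τ := by positivity
        rw [abs_le]
        constructor <;> nlinarith [sq_nonneg (W n ω)]
    _ = _ := by
        rw [integral_add (hU2.const_mul _) (hW2.const_mul _), integral_const_mul,
          integral_const_mul]

/-- Norm bound for the first moment by the second one. -/
lemma integral_abs_le_sqrt {f : Ω → ℝ} (hf : MemLp f 2 P) :
    ∫ ω, |f ω| ∂P ≤ √(∫ ω, f ω ^ 2 ∂P) := by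
  have h := variance_nonneg |f| P
  rw [variance_eq_sub hf.abs] at h
  apply Real.le_sqrt_of_sq_le
  simpa [sq_abs] using h

end

end BlockCLT

/-! ### Cells, step functions and characteristic functions -/

namespace BlockCLT

lemma mem_cell_iff (k : ℕ) (j : ℤ) (x : ℝ) : x ∈ cell k j ↔ ⌊4 ^ k * x⌋ = j := by
  have h : (0 : ℝ) < 4 ^ k := by positivity
  rw [cell, Set.mem_Ico, Int.floor_eq_iff, div_le_iff₀' h, lt_div_iff₀' h]

lemma measurableSet_cell (k : ℕ) (j : ℤ) : MeasurableSet (cell k j) := measurableSet_Ico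

/-- The step function with value `c j` on the cell `cell k j`, `j ∈ J`. -/
noncomputable def cellStep (k : ℕ) (J : Finset ℤ) (c : ℤ → ℂ) (x : ℝ) : ℂ :=
  ∑ j ∈ J, (cell k j).indicator (fun _ => c j) x

lemma cellStep_eq (k : ℕ) (J : Finset ℤ) (c : ℤ → ℂ) (x : ℝ) :
    cellStep k J c x = if ⌊4 ^ k * x⌋ ∈ J then c ⌊4 ^ k * x⌋ else 0 := by
  classical
  simp [cellStep, Set.indicator_apply, mem_cell_iff]

lemma measurable_cellStep (k : ℕ) (J : Finset ℤ) (c : ℤ → ℂ) : Measurable (cellStep k J c) := by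
  unfold cellStep
  exact Finset.measurable_fun_sum _ fun j _ => measurable_const.indicator (measurableSet_cell k j)

lemma norm_exp_ofReal_mul_I_sub_le (x y : ℝ) :
    ‖Complex.exp (x * Complex.I) - Complex.exp (y * Complex.I)‖ ≤ |x - y| := by
  have h : Complex.exp (x * Complex.I) - Complex.exp (y * Complex.I) =
      Complex.exp (y * Complex.I) * (Complex.exp (Complex.I * (x - y : ℝ)) - 1) := by
    rw [mul_sub, ← Complex.exp_add]; push_cast; ring_nf
  rw [h, norm_mul, Complex.norm_exp_ofReal_mul_I, one_mul]
  exact Real.norm_exp_I_mul_ofReal_sub_one_le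

/-- Exponentials are approximated by step functions on finitely many cells. -/
lemma exists_cellStep_approx (s : ℝ) {η : ℝ} (hη : 0 < η) :
    ∃ (k : ℕ) (J : Finset ℤ) (c : ℤ → ℂ), (∀ x, ‖cellStep k J c x‖ ≤ 1) ∧
      ∀ x : ℝ, ‖Complex.exp ((s * x : ℝ) * Complex.I) - cellStep k J c x‖ ≤ η * (1 + x ^ 2) := by
  -- The mesh makes the oscillation `|s| / 4 ^ k` at most `η` on a cell. Outside the cells of `J`,
  -- `|x| ≥ 1 / η + 1`, so that `1 ≤ η x ^ 2`: the weight `1 + x ^ 2` lets second moments control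
  -- the tail.
  obtain ⟨k, hk⟩ : ∃ k : ℕ, |s| / η < 4 ^ k := pow_unbounded_of_one_lt _ (by norm_num)
  have h4 : (0 : ℝ) < 4 ^ k := by positivity
  obtain ⟨N, hN⟩ := exists_nat_ge ((4 : ℝ) ^ k * (1 / η + 1))
  set c : ℤ → ℂ := fun j => Complex.exp ((s * (j / 4 ^ k) : ℝ) * Complex.I) with hc
  have hc1 : ∀ j, ‖c j‖ = 1 := fun j => Complex.norm_exp_ofReal_mul_I _
  refine ⟨k, Finset.Icc (-(N : ℤ)) N, c, fun x => ?_, fun x => ?_⟩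
  · rw [cellStep_eq]; split_ifs <;> simp [hc1]
  rw [cellStep_eq]
  have hfl := Int.floor_le ((4 : ℝ) ^ k * x)
  have hlt := Int.lt_floor_add_one ((4 : ℝ) ^ k * x)
  split_ifs with h
  · refine (norm_exp_ofReal_mul_I_sub_le _ _).trans ?_
    rw [← mul_sub, abs_mul]
    have h1 : |x - (⌊(4 : ℝ) ^ k * x⌋ : ℝ) / 4 ^ k| ≤ 1 / 4 ^ k := by
      have h2 : x - (⌊(4 : ℝ) ^ k * x⌋ : ℝ) / 4 ^ k =
          (4 ^ k * x - ⌊(4 : ℝ) ^ k * x⌋) / 4 ^ k := by field_simp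
      rw [h2, abs_div, abs_of_pos h4]
      gcongr
      rw [abs_le]; constructor <;> linarith
    calc _ ≤ |s| * (1 / 4 ^ k) := by gcongr
      _ ≤ η := by
        rw [mul_one_div, div_le_iff₀ h4]
        rw [div_lt_iff₀ hη] at hk
        linarith
      _ ≤ _ := by nlinarith [sq_nonneg x]
  · rw [sub_zero, Complex.norm_exp_ofReal_mul_I]
    have hx : 1 / η + 1 ≤ |x| := by
      have h5 : (N : ℝ) ≤ 4 ^ k * |x| := by
        rw [show 4 ^ k * |x| = |4 ^ k * x| by rw [abs_mul, abs_of_pos h4]]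
        rw [Finset.mem_Icc, not_and_or, not_le, not_le] at h
        rcases h with h | h
        · have : (⌊(4 : ℝ) ^ k * x⌋ : ℝ) + 1 ≤ -N := by exact_mod_cast h
          exact le_trans (by linarith) (neg_le_abs _)
        · have : (N : ℝ) ≤ ⌊(4 : ℝ) ^ k * x⌋ := by exact_mod_cast h.le
          exact le_trans (by linarith) (le_abs_self _)
      exact le_of_mul_le_mul_left (hN.trans h5) h4
    have h6 : 1 / η ≤ x ^ 2 := by
      rw [← sq_abs]
      have : 0 < 1 / η := by positivity
      nlinarith
    rw [div_le_iff₀' hη] at h6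
    nlinarith

section

variable {Ω : Type*} [MeasurableSpace Ω] {P : Measure Ω} [IsProbabilityMeasure P]

omit [IsProbabilityMeasure P] in
lemma aestronglyMeasurable_exp {Z : Ω → ℝ} (hZ : AEStronglyMeasurable Z P) :
    AEStronglyMeasurable (fun ω => Complex.exp ((Z ω : ℝ) * Complex.I)) P := by
  have : Continuous fun x : ℝ => Complex.exp (x * Complex.I) := by fun_prop
  exact this.comp_aestronglyMeasurable hZ

lemma integrable_exp {Z : Ω → ℝ} (hZ : AEStronglyMeasurable Z P) :
    Integrable (fun ω => Complex.exp ((Z ω : ℝ) * Complex.I)) P :=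
  Integrable.of_bound (aestronglyMeasurable_exp hZ) 1
    (Eventually.of_forall fun _ => (Complex.norm_exp_ofReal_mul_I _).le)

lemma norm_integral_exp_le_one (Z : Ω → ℝ) :
    ‖∫ ω, Complex.exp ((Z ω : ℝ) * Complex.I) ∂P‖ ≤ 1 := by
  simpa using norm_integral_le_of_norm_le_const (μ := P) (C := 1)
    (Eventually.of_forall fun ω => (Complex.norm_exp_ofReal_mul_I (Z ω)).le)

lemma norm_integral_exp_sub_le {U V : Ω → ℝ} (hU : AEStronglyMeasurable U P)
    (hV : AEStronglyMeasurable V P) (hUV : Integrable (fun ω => U ω - V ω) P) :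
    ‖(∫ ω, Complex.exp ((U ω : ℝ) * Complex.I) ∂P) - ∫ ω, Complex.exp ((V ω : ℝ) * Complex.I) ∂P‖
      ≤ ∫ ω, |U ω - V ω| ∂P := by
  rw [← integral_sub (integrable_exp hU) (integrable_exp hV)]
  exact norm_integral_le_of_norm_le hUV.abs
    (Eventually.of_forall fun ω => norm_exp_ofReal_mul_I_sub_le _ _)

omit [IsProbabilityMeasure P] in
lemma aestronglyMeasurable_cellStep {Z : Ω → ℝ} (hZ : AEStronglyMeasurable Z P) (k : ℕ)
    (J : Finset ℤ) (c : ℤ → ℂ) : AEStronglyMeasurable (fun ω => cellStep k J c (Z ω)) P :=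
  ((measurable_cellStep k J c).comp_aemeasurable hZ.aemeasurable).aestronglyMeasurable

omit [IsProbabilityMeasure P] in
lemma nullMeasurableSet_cell {Z : Ω → ℝ} (hZ : AEStronglyMeasurable Z P) (k : ℕ) (j : ℤ) :
    NullMeasurableSet {ω | Z ω ∈ cell k j} P :=
  hZ.aemeasurable.nullMeasurableSet_preimage (measurableSet_cell k j)

lemma integral_cellStep {Z : Ω → ℝ} (hZ : AEStronglyMeasurable Z P) (k : ℕ) (J : Finset ℤ)
    (c : ℤ → ℂ) :
    ∫ ω, cellStep k J c (Z ω) ∂P = ∑ j ∈ J, P.real {ω | Z ω ∈ cell k j} * c j := by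
  have h : ∀ j, (fun ω => (cell k j).indicator (fun _ => c j) (Z ω)) =
      {ω | Z ω ∈ cell k j}.indicator (fun _ => c j) := fun j => rfl
  simp only [cellStep]
  rw [integral_finsetSum]
  · refine Finset.sum_congr rfl fun j _ => ?_
    rw [h, integral_indicator₀ (nullMeasurableSet_cell hZ k j), setIntegral_const,
      Complex.real_smul]
  · intro j _
    rw [h]
    exact (integrable_const _).indicator₀ (nullMeasurableSet_cell hZ k j)

lemma integral_cellStep_mul {Z Z' : Ω → ℝ} (hZ : AEStronglyMeasurable Z P)
    (hZ' : AEStronglyMeasurable Z' P) (k : ℕ) (J : Finset ℤ) (c : ℤ → ℂ) :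
    ∫ ω, cellStep k J c (Z ω) * cellStep k J c (Z' ω) ∂P =
      ∑ j ∈ J, ∑ j' ∈ J, P.real ({ω | Z ω ∈ cell k j} ∩ {ω | Z' ω ∈ cell k j'}) *
        (c j * c j') := by
  have h : ∀ j j', (fun ω => (cell k j).indicator (fun _ => c j) (Z ω) *
      (cell k j').indicator (fun _ => c j') (Z' ω)) =
      ({ω | Z ω ∈ cell k j} ∩ {ω | Z' ω ∈ cell k j'}).indicator (fun _ => c j * c j') := by
    intro j j'
    ext ω
    rw [Set.inter_indicator_mul]
    rfl
  have hn := fun j j' =>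
    (nullMeasurableSet_cell hZ k j).inter (nullMeasurableSet_cell hZ' k j')
  have hi : ∀ j j', Integrable (fun ω => (cell k j).indicator (fun _ => c j) (Z ω) *
      (cell k j').indicator (fun _ => c j') (Z' ω)) P := by
    intro j j'
    rw [h]
    exact (integrable_const _).indicator₀ (hn j j')
  simp only [cellStep, Finset.sum_mul_sum]
  rw [integral_finsetSum _ fun j _ => integrable_finsetSum _ fun j' _ => hi j j']
  refine Finset.sum_congr rfl fun j _ => ?_
  rw [integral_finsetSum _ fun j' _ => hi j j']
  refine Finset.sum_congr rfl fun j' _ => ?_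
  rw [h, integral_indicator₀ (hn j j'), setIntegral_const, Complex.real_smul]

/-- Asymptotic identity in law and independence on cells imply the asymptotic factorization of
characteristic functions. -/
lemma tendsto_integral_exp_add_sub_sq {ι : Type*} {l : Filter ι} {Z Z' : ι → Ω → ℝ} {K : ℝ}
    (hZ : ∀ n, MemLp (Z n) 2 P) (hZ' : ∀ n, MemLp (Z' n) 2 P)
    (hK : ∀ᶠ n in l, ∫ ω, Z n ω ^ 2 ∂P ≤ K) (hK' : ∀ᶠ n in l, ∫ ω, Z' n ω ^ 2 ∂P ≤ K)
    (hS : ∀ (k : ℕ) (j : ℤ), Tendsto (fun n => P.real {ω | Z n ω ∈ cell k j} -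
      P.real {ω | Z' n ω ∈ cell k j}) l (𝓝 0))
    (hI : ∀ (k : ℕ) (j j' : ℤ), Tendsto (fun n =>
      P.real ({ω | Z n ω ∈ cell k j} ∩ {ω | Z' n ω ∈ cell k j'}) -
        P.real {ω | Z n ω ∈ cell k j} * P.real {ω | Z' n ω ∈ cell k j'}) l (𝓝 0)) (s : ℝ) :
    Tendsto (fun n => (∫ ω, Complex.exp ((s * (Z n ω + Z' n ω) : ℝ) * Complex.I) ∂P) -
      (∫ ω, Complex.exp ((s * Z n ω : ℝ) * Complex.I) ∂P) ^ 2) l (𝓝 0) := by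
  rw [Metric.tendsto_nhds]
  intro η hη
  -- Passing to step functions costs `2 η₁ (1 + |K|)` in the joint term and as much in the square,
  -- together `η / 2`.
  set η₁ := η / (8 * (1 + |K|)) with hη₁
  have hη₁0 : 0 < η₁ := by positivity
  have hη₁K : 4 * (η₁ * (1 + |K|)) = η / 2 := by rw [hη₁]; field_simp; ring
  obtain ⟨k, J, c, hf1, hfa⟩ := exists_cellStep_approx s hη₁0
  set f := cellStep k J c with hf
  -- For step functions the claim is a finite combination of cell probabilities: `hI` factors the
  -- joint integral, then `hS` replaces `Z'` by `Z` in one factor.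
  have hlim : Tendsto (fun n => (∫ ω, f (Z n ω) * f (Z' n ω) ∂P) - (∫ ω, f (Z n ω) ∂P) ^ 2) l
      (𝓝 0) := by
    have h1 : Tendsto (fun n => (∫ ω, f (Z n ω) ∂P) - ∫ ω, f (Z' n ω) ∂P) l (𝓝 0) := by
      have : Tendsto (fun n => ∑ j ∈ J, ((P.real {ω | Z n ω ∈ cell k j} -
          P.real {ω | Z' n ω ∈ cell k j} : ℝ) : ℂ) * c j) l (𝓝 (∑ j ∈ J, ((0 : ℝ) : ℂ) * c j)) :=
        tendsto_finsetSum _ fun j _ => (hS k j).ofReal.mul_const _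
      simp only [Complex.ofReal_zero, zero_mul, Finset.sum_const_zero] at this
      refine this.congr fun n => ?_
      rw [hf, integral_cellStep (hZ n).1, integral_cellStep (hZ' n).1, ← Finset.sum_sub_distrib]
      exact Finset.sum_congr rfl fun j _ => by push_cast; ring
    have h2 : Tendsto (fun n => (∫ ω, f (Z n ω) * f (Z' n ω) ∂P) -
        (∫ ω, f (Z n ω) ∂P) * ∫ ω, f (Z' n ω) ∂P) l (𝓝 0) := by
      have : Tendsto (fun n => ∑ j ∈ J, ∑ j' ∈ J,
          ((P.real ({ω | Z n ω ∈ cell k j} ∩ {ω | Z' n ω ∈ cell k j'}) -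
          P.real {ω | Z n ω ∈ cell k j} * P.real {ω | Z' n ω ∈ cell k j'} : ℝ) : ℂ) *
          (c j * c j')) l (𝓝 (∑ j ∈ J, ∑ j' ∈ J, ((0 : ℝ) : ℂ) * (c j * c j'))) :=
        tendsto_finsetSum _ fun j _ => tendsto_finsetSum _ fun j' _ =>
          (hI k j j').ofReal.mul_const _
      simp only [Complex.ofReal_zero, zero_mul, Finset.sum_const_zero] at this
      refine this.congr fun n => ?_
      rw [hf, integral_cellStep_mul (hZ n).1 (hZ' n).1, integral_cellStep (hZ n).1,
        integral_cellStep (hZ' n).1, Finset.sum_mul_sum, ← Finset.sum_sub_distrib]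
      refine Finset.sum_congr rfl fun j _ => ?_
      rw [← Finset.sum_sub_distrib]
      exact Finset.sum_congr rfl fun j' _ => by push_cast; ring
    have h3 : Tendsto (fun n => (∫ ω, f (Z n ω) ∂P) *
        ((∫ ω, f (Z n ω) ∂P) - ∫ ω, f (Z' n ω) ∂P)) l (𝓝 0) := by
      refine squeeze_zero_norm (fun n => ?_) (by simpa using h1.norm)
      rw [norm_mul]
      refine mul_le_of_le_one_left (norm_nonneg _) ?_
      simpa using norm_integral_le_of_norm_le_const (μ := P) (C := 1)
        (Eventually.of_forall fun ω => hf1 (Z n ω))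
    have := h2.sub h3
    rw [sub_zero] at this
    exact this.congr fun n => by ring
  filter_upwards [hK, hK', (Metric.tendsto_nhds.1 hlim) (η / 2) (half_pos hη)] with n hn hn' hl
  rw [dist_zero_right] at hl ⊢
  set e : ℝ → ℂ := fun x => Complex.exp ((s * x : ℝ) * Complex.I) with he
  have he1 : ∀ x, ‖e x‖ = 1 := fun x => Complex.norm_exp_ofReal_mul_I _
  have hadd : ∀ x y, e (x + y) = e x * e y := fun x y => by
    simp only [he, ← Complex.exp_add]; push_cast; ring_nf
  have hZe : AEStronglyMeasurable (fun ω => e (Z n ω)) P :=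
    aestronglyMeasurable_exp ((hZ n).1.const_mul s)
  have hZe' : AEStronglyMeasurable (fun ω => e (Z' n ω)) P :=
    aestronglyMeasurable_exp ((hZ' n).1.const_mul s)
  have hZf := aestronglyMeasurable_cellStep (hZ n).1 k J c
  have hZf' := aestronglyMeasurable_cellStep (hZ' n).1 k J c
  have hZ2 := (hZ n).integrable_sq
  have hZ2' := (hZ' n).integrable_sq
  have hb : Integrable (fun ω => η₁ * (1 + Z n ω ^ 2)) P :=
    ((integrable_const _).add hZ2).const_mul _
  have hb' : Integrable (fun ω => η₁ * (1 + Z' n ω ^ 2)) P :=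
    ((integrable_const _).add hZ2').const_mul _
  have hbv : ∫ ω, η₁ * (1 + Z n ω ^ 2) ∂P ≤ η₁ * (1 + |K|) := by
    rw [integral_const_mul, integral_add (integrable_const _) hZ2]
    simp only [integral_const, probReal_univ, one_smul]
    gcongr; exact hn.trans (le_abs_self K)
  have hbv' : ∫ ω, η₁ * (1 + Z' n ω ^ 2) ∂P ≤ η₁ * (1 + |K|) := by
    rw [integral_const_mul, integral_add (integrable_const _) hZ2']
    simp only [integral_const, probReal_univ, one_smul]
    gcongr; exact hn'.trans (le_abs_self K)
  have hE1 : ‖(∫ ω, e (Z n ω) ∂P) - ∫ ω, f (Z n ω) ∂P‖ ≤ η₁ * (1 + |K|) := by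
    rw [← integral_sub
      (Integrable.of_bound hZe 1 (Eventually.of_forall fun ω => (he1 _).le))
      (Integrable.of_bound hZf 1 (Eventually.of_forall fun ω => hf1 _))]
    exact (norm_integral_le_of_norm_le hb (Eventually.of_forall fun ω => hfa _)).trans hbv
  have hE2 : ‖(∫ ω, e (Z n ω + Z' n ω) ∂P) - ∫ ω, f (Z n ω) * f (Z' n ω) ∂P‖ ≤
      2 * (η₁ * (1 + |K|)) := by
    simp only [hadd]
    have hee : Integrable (fun ω => e (Z n ω) * e (Z' n ω)) P :=
      Integrable.of_bound (hZe.mul hZe') 1 (Eventually.of_forall fun ω => by simp [he1])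
    have hff : Integrable (fun ω => f (Z n ω) * f (Z' n ω)) P :=
      Integrable.of_bound (hZf.mul hZf') 1 (Eventually.of_forall fun ω => by
        rw [norm_mul]
        exact mul_le_one₀ (hf1 _) (norm_nonneg _) (hf1 _))
    rw [← integral_sub hee hff]
    refine (norm_integral_le_of_norm_le (hb.add hb') (Eventually.of_forall fun ω => ?_)).trans ?_
    · have : e (Z n ω) * e (Z' n ω) - f (Z n ω) * f (Z' n ω) =
          (e (Z n ω) - f (Z n ω)) * e (Z' n ω) + f (Z n ω) * (e (Z' n ω) - f (Z' n ω)) := by ring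
      rw [this]
      refine (norm_add_le _ _).trans ?_
      rw [norm_mul, norm_mul, he1, mul_one]
      exact add_le_add (hfa _)
        ((mul_le_of_le_one_left (norm_nonneg _) (hf1 _)).trans (hfa _))
    · simp only [Pi.add_apply]
      rw [integral_add hb hb']
      linarith
  have hA : ‖∫ ω, e (Z n ω) ∂P‖ ≤ 1 := norm_integral_exp_le_one fun ω => s * Z n ω
  have hB : ‖∫ ω, f (Z n ω) ∂P‖ ≤ 1 := by
    simpa using norm_integral_le_of_norm_le_const (μ := P) (C := 1)
      (Eventually.of_forall fun ω => hf1 (Z n ω))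
  have hE3 : ‖(∫ ω, e (Z n ω) ∂P) ^ 2 - (∫ ω, f (Z n ω) ∂P) ^ 2‖ ≤ 2 * (η₁ * (1 + |K|)) := by
    rw [sq_sub_sq, norm_mul]
    exact mul_le_mul ((norm_add_le _ _).trans (by linarith)) hE1 (norm_nonneg _) (by norm_num)
  calc ‖(∫ ω, e (Z n ω + Z' n ω) ∂P) - (∫ ω, e (Z n ω) ∂P) ^ 2‖
      = ‖((∫ ω, e (Z n ω + Z' n ω) ∂P) - ∫ ω, f (Z n ω) * f (Z' n ω) ∂P) -
        ((∫ ω, e (Z n ω) ∂P) ^ 2 - (∫ ω, f (Z n ω) ∂P) ^ 2) +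
        ((∫ ω, f (Z n ω) * f (Z' n ω) ∂P) - (∫ ω, f (Z n ω) ∂P) ^ 2)‖ := by congr 1; ring
    _ ≤ _ := (norm_add_le _ _).trans (add_le_add_left (norm_sub_le _ _) _)
    _ < η := by linarith

/-- Taylor's bound for `|x| ≤ 1`; beyond that every term is dominated by `|x| ^ 3`. Only the cubic
order matters later, not the constant. -/
lemma norm_exp_sub_taylor_le (x : ℝ) :
    ‖Complex.exp (x * Complex.I) - ((1 - x ^ 2 / 2 : ℝ) + (x : ℝ) * Complex.I)‖ ≤ 4 * |x| ^ 3 := by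
  rcases le_or_gt |x| 1 with h | h
  · have := Complex.exp_bound (x := x * Complex.I) (by simpa using h) (n := 3) (by norm_num)
    simp only [Finset.sum_range_succ, Finset.sum_range_zero] at this
    have hx : Complex.exp (x * Complex.I) - ((1 - x ^ 2 / 2 : ℝ) + (x : ℝ) * Complex.I) =
        Complex.exp (x * Complex.I) - (0 + (x * Complex.I) ^ 0 / (Nat.factorial 0 : ℂ) +
          (x * Complex.I) ^ 1 / (Nat.factorial 1 : ℂ) +
          (x * Complex.I) ^ 2 / (Nat.factorial 2 : ℂ)) := by
      simp only [mul_pow, Complex.I_sq, Nat.factorial]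
      push_cast
      ring
    rw [hx]
    refine this.trans ?_
    have h3 : (0 : ℝ) ≤ |x| ^ 3 := by positivity
    simp [Nat.factorial]
    linarith
  · have h1 : ‖((1 - x ^ 2 / 2 : ℝ) + (x : ℝ) * Complex.I : ℂ)‖ ≤ (1 + |x| ^ 2 / 2) + |x| := by
      refine (norm_add_le _ _).trans ?_
      rw [norm_mul, Complex.norm_I, mul_one, Complex.norm_real, Complex.norm_real,
        Real.norm_eq_abs, Real.norm_eq_abs]
      gcongr
      rw [sq_abs, abs_le]
      constructor <;> nlinarith [sq_nonneg x]
    refine (norm_sub_le _ _).trans ?_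
    rw [Complex.norm_exp_ofReal_mul_I]
    have h2 : |x| ≤ |x| ^ 2 := by nlinarith
    have h3 : |x| ^ 2 ≤ |x| ^ 3 := by nlinarith [sq_nonneg |x|]
    linarith

/-- Second order expansion of the characteristic function of a standardized variable. -/
lemma norm_integral_exp_sub_le_of_standardized {Z : Ω → ℝ} (hZ : MemLp Z 4 P)
    (h0 : ∫ ω, Z ω ∂P = 0) (h1 : ∫ ω, Z ω ^ 2 ∂P = 1) (s : ℝ) :
    ‖(∫ ω, Complex.exp ((s * Z ω : ℝ) * Complex.I) ∂P) - (1 - s ^ 2 / 2 : ℝ)‖ ≤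
      4 * (1 + ∫ ω, Z ω ^ 4 ∂P) * |s| ^ 3 := by
  have hi1 : Integrable Z P := by simpa using integrable_pow_of_memLp hZ (p := 1) (by norm_num)
  have hi2 := integrable_pow_of_memLp hZ (p := 2) (by norm_num)
  have hi4 := integrable_pow_of_memLp hZ (p := 4) le_rfl
  have hr : Integrable (fun ω => 1 - (s * Z ω) ^ 2 / 2) P := by
    simp only [mul_pow]
    exact (integrable_const _).sub ((hi2.const_mul _).div_const _)
  have hT : Integrable (fun ω => ((1 - (s * Z ω) ^ 2 / 2 : ℝ) : ℂ) +
      ((s * Z ω : ℝ) : ℂ) * Complex.I) P :=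
    hr.ofReal.add ((hi1.const_mul s).ofReal.mul_const _)
  have hTv : ∫ ω, (((1 - (s * Z ω) ^ 2 / 2 : ℝ) : ℂ) + ((s * Z ω : ℝ) : ℂ) * Complex.I) ∂P =
      (1 - s ^ 2 / 2 : ℝ) := by
    rw [integral_add hr.ofReal ((hi1.const_mul s).ofReal.mul_const _), integral_mul_const,
      integral_complex_ofReal, integral_complex_ofReal, integral_const_mul, h0]
    simp only [mul_pow]
    rw [integral_sub (integrable_const _) ((hi2.const_mul _).div_const _), integral_div,
      integral_const_mul, h1]
    simp
  rw [← hTv, ← integral_sub (integrable_exp (hZ.1.const_mul s)) hT]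
  have hbound : Integrable (fun ω => 4 * |s| ^ 3 * (1 + Z ω ^ 4)) P :=
    ((integrable_const _).add hi4).const_mul _
  refine (norm_integral_le_of_norm_le hbound (Eventually.of_forall fun ω => ?_)).trans ?_
  · refine (norm_exp_sub_taylor_le _).trans ?_
    rw [abs_mul, mul_pow, ← mul_assoc]
    gcongr
    rw [← abs_pow_four]
    nlinarith [abs_nonneg (Z ω), sq_nonneg (|Z ω| ^ 2 - |Z ω|), sq_nonneg (|Z ω| ^ 2 - 1)]
  · rw [integral_const_mul, integral_add (integrable_const _) hi4]
    simp only [integral_const, probReal_univ, one_smul]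
    exact le_of_eq (by ring)

end

end BlockCLT

/-! ### The moment recursion -/

namespace BlockCLT

/-- Products of a bounded and a vanishing sequence vanish. -/
lemma tendsto_mul_zero_of_abs_le {x y : ℕ → ℝ} {K : ℝ} (hx : ∀ᶠ n in atTop, |x n| ≤ K)
    (hy : Tendsto y atTop (𝓝 0)) : Tendsto (fun n => x n * y n) atTop (𝓝 0) := by
  have hy' : Tendsto (fun n => K * |y n|) atTop (𝓝 0) := by
    simpa using ((tendsto_zero_iff_abs_tendsto_zero _).1 hy).const_mul K
  refine squeeze_zero_norm' (hx.mono fun n hn => ?_) hy'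
  rw [Real.norm_eq_abs, abs_mul]
  exact mul_le_mul_of_nonneg_right hn (abs_nonneg _)

section

variable {Ω : Type*} [MeasurableSpace Ω] {P : Measure Ω} [IsProbabilityMeasure P]

/-- A standardized sequence `S` such that `S n` is a multiple of `Y n + Y' n + ζ n`, where
`Y n = S (u n) + δ n`, `δ` and `ζ` are small in `L⁴`, and `Y n`, `Y' n` have asymptotically the same
moments and asymptotically factorizing mixed moments. -/
structure MomentSplitting (P : Measure Ω) (S : ℕ → Ω → ℝ) (u : ℕ → ℕ) (r : ℕ → ℝ)
    (δ Y' ζ : ℕ → Ω → ℝ) : Prop where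
  memS : ∀ n, MemLp (S n) 4 P
  memδ : ∀ n, MemLp (δ n) 4 P
  memY' : ∀ n, MemLp (Y' n) 4 P
  memζ : ∀ n, MemLp (ζ n) 4 P
  -- Index `0` is excluded: the empty sum has second moment `0`. The field `one_le` keeps `u n` away
  -- from it.
  mean : ∀ n, 1 ≤ n → ∫ ω, S n ω ∂P = 0
  sq : ∀ n, 1 ≤ n → ∫ ω, S n ω ^ 2 ∂P = 1
  one_le : ∀ n, 1 ≤ u n
  lt : ∀ᶠ n in atTop, u n < n
  tendsto_u : Tendsto u atTop atTop
  r_nonneg : ∀ n, 0 ≤ r n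
  eq : ∀ᶠ n in atTop, ∀ ω, S n ω = r n * ((S (u n) ω + δ n ω) + Y' n ω + ζ n ω)
  tendsto_δ : Tendsto (fun n => ∫ ω, δ n ω ^ 4 ∂P) atTop (𝓝 0)
  tendsto_ζ : Tendsto (fun n => ∫ ω, ζ n ω ^ 4 ∂P) atTop (𝓝 0)
  moment : ∀ p ≤ 4, Tendsto (fun n => (∫ ω, (S (u n) ω + δ n ω) ^ p ∂P) - ∫ ω, Y' n ω ^ p ∂P)
    atTop (𝓝 0)
  mixed : ∀ p q : ℕ, 1 ≤ p → 1 ≤ q → p + q ≤ 4 → Tendsto (fun n =>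
    (∫ ω, (S (u n) ω + δ n ω) ^ p * Y' n ω ^ q ∂P) -
      (∫ ω, (S (u n) ω + δ n ω) ^ p ∂P) * ∫ ω, Y' n ω ^ q ∂P) atTop (𝓝 0)

namespace MomentSplitting

variable {S : ℕ → Ω → ℝ} {u : ℕ → ℕ} {r : ℕ → ℝ} {δ Y' ζ : ℕ → Ω → ℝ}

omit [IsProbabilityMeasure P] in
lemma memY (h : MomentSplitting P S u r δ Y' ζ) (n : ℕ) :
    MemLp (fun ω => S (u n) ω + δ n ω) 4 P := (h.memS _).add (h.memδ n)

omit [IsProbabilityMeasure P] in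
lemma memYY' (h : MomentSplitting P S u r δ Y' ζ) (n : ℕ) :
    MemLp (fun ω => S (u n) ω + δ n ω + Y' n ω) 4 P := (h.memY n).add (h.memY' n)

/-- `S (u n)` is centred, so only the mean of `δ n` remains. The exponent `1` is kept so that the
term matches those of `mixed`. -/
lemma tendsto_first (h : MomentSplitting P S u r δ Y' ζ) :
    Tendsto (fun n => ∫ ω, (S (u n) ω + δ n ω) ^ 1 ∂P) atTop (𝓝 0) := by
  have hδ := tendsto_integral_pow_of_four le_rfl (by norm_num) h.memδ h.tendsto_δ
  refine hδ.congr fun n => ?_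
  have hi : ∀ {f : Ω → ℝ}, MemLp f 4 P → Integrable f P := fun hf => by
    simpa using integrable_pow_of_memLp hf (p := 1) (by norm_num)
  simp only [pow_one]
  rw [integral_add (hi (h.memS _)) (hi (h.memδ n)), h.mean _ (h.one_le n), zero_add]

lemma tendsto_first' (h : MomentSplitting P S u r δ Y' ζ) :
    Tendsto (fun n => ∫ ω, Y' n ω ^ 1 ∂P) atTop (𝓝 0) := by
  simpa using h.tendsto_first.sub (h.moment 1 (by norm_num))

/-- The `L²` perturbation lemma needs only the unit second moment of `S (u n)`; a bound on fourth
moments is not yet available. -/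
lemma tendsto_second (h : MomentSplitting P S u r δ Y' ζ) :
    Tendsto (fun n => ∫ ω, (S (u n) ω + δ n ω) ^ 2 ∂P) atTop (𝓝 1) := by
  have h2 : ∀ {f : Ω → ℝ}, MemLp f 4 P → MemLp f 2 P := fun hf => hf.mono_exponent (by norm_num)
  have := tendsto_integral_add_sq_sub (l := atTop) (K := 1) (fun n => h2 (h.memS (u n)))
    (fun n => h2 (h.memδ n)) (Eventually.of_forall fun n => (h.sq _ (h.one_le n)).le)
    (tendsto_integral_pow_of_four (by norm_num) (by norm_num) h.memδ h.tendsto_δ)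
  simp only [h.sq _ (h.one_le _)] at this
  simpa using this.add_const 1

lemma tendsto_second' (h : MomentSplitting P S u r δ Y' ζ) :
    Tendsto (fun n => ∫ ω, Y' n ω ^ 2 ∂P) atTop (𝓝 1) := by
  simpa using h.tendsto_second.sub (h.moment 2 (by norm_num))

lemma tendsto_sum_sq (h : MomentSplitting P S u r δ Y' ζ) :
    Tendsto (fun n => ∫ ω, (S (u n) ω + δ n ω + Y' n ω) ^ 2 ∂P) atTop (𝓝 2) := by
  have h11 : Tendsto (fun n => ∫ ω, (S (u n) ω + δ n ω) ^ 1 * Y' n ω ^ 1 ∂P) atTop (𝓝 0) := by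
    simpa using (h.mixed 1 1 le_rfl le_rfl (by norm_num)).add
      (h.tendsto_first.mul h.tendsto_first')
  have := (h.tendsto_second.add (h11.const_mul 2)).add h.tendsto_second'
  rw [show (1 : ℝ) + 2 * 0 + 1 = 2 by norm_num] at this
  refine this.congr fun n => ?_
  have i1 := integrable_pow_of_memLp (h.memY n) (p := 2) (by norm_num)
  have i2 := integrable_pow_of_memLp (h.memY' n) (p := 2) (by norm_num)
  have i3 := integrable_pow_mul_pow (h.memY n) (h.memY' n) (p := 1) (q := 1) (by norm_num)
  rw [← integral_const_mul, ← integral_add' i1 (i3.const_mul _),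
    ← integral_add' (i1.add (i3.const_mul _)) i2]
  exact integral_congr_ae (Eventually.of_forall fun ω => by simp only [Pi.add_apply]; ring)

omit [IsProbabilityMeasure P] in
lemma integral_pow_eq (h : MomentSplitting P S u r δ Y' ζ) (p : ℕ) :
    ∀ᶠ n in atTop, ∫ ω, S n ω ^ p ∂P =
      r n ^ p * ∫ ω, (S (u n) ω + δ n ω + Y' n ω + ζ n ω) ^ p ∂P := by
  filter_upwards [h.eq] with n hn
  rw [← integral_const_mul]
  exact integral_congr_ae (Eventually.of_forall fun ω => by simp only [hn ω, mul_pow])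

/-- Second moments in the splitting give `1 = r n ^ 2 * E` with `E → 2`; the sign of `r n` decides
the root. -/
lemma tendsto_r (h : MomentSplitting P S u r δ Y' ζ) : Tendsto r atTop (𝓝 (√2)⁻¹) := by
  have h2 : ∀ {f : Ω → ℝ}, MemLp f 4 P → MemLp f 2 P := fun hf => hf.mono_exponent (by norm_num)
  have h1 := (tendsto_integral_add_sq_sub (l := atTop) (K := 3) (fun n => h2 (h.memYY' n))
    (fun n => h2 (h.memζ n))
    ((h.tendsto_sum_sq.eventually_lt_const (by norm_num)).mono fun n hn => hn.le)
    (tendsto_integral_pow_of_four (by norm_num) (by norm_num) h.memζ h.tendsto_ζ)).add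
    h.tendsto_sum_sq
  simp only [sub_add_cancel, zero_add] at h1
  have h3 := (h1.sqrt).inv₀ (by positivity)
  refine h3.congr' ?_
  filter_upwards [h.integral_pow_eq 2, eventually_ge_atTop 1] with n hn hn1
  rw [h.sq n hn1] at hn
  rw [← Real.sqrt_inv, ← Real.sqrt_sq (h.r_nonneg n)]
  congr 1
  exact (eq_inv_of_mul_eq_one_left hn.symm).symm

lemma integral_sum_pow_four (h : MomentSplitting P S u r δ Y' ζ) (n : ℕ) :
    ∫ ω, (S (u n) ω + δ n ω + Y' n ω) ^ 4 ∂P =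
      (∫ ω, (S (u n) ω + δ n ω) ^ 4 ∂P) + 4 * (∫ ω, (S (u n) ω + δ n ω) ^ 3 * Y' n ω ^ 1 ∂P) +
      6 * (∫ ω, (S (u n) ω + δ n ω) ^ 2 * Y' n ω ^ 2 ∂P) +
      4 * (∫ ω, (S (u n) ω + δ n ω) ^ 1 * Y' n ω ^ 3 ∂P) + ∫ ω, Y' n ω ^ 4 ∂P := by
  have i1 := integrable_pow_of_memLp (h.memY n) (p := 4) le_rfl
  have i2 := integrable_pow_of_memLp (h.memY' n) (p := 4) le_rfl
  have i31 := (integrable_pow_mul_pow (h.memY n) (h.memY' n) (p := 3) (q := 1) le_rfl).const_mul 4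
  have i22 := (integrable_pow_mul_pow (h.memY n) (h.memY' n) (p := 2) (q := 2) le_rfl).const_mul 6
  have i13 := (integrable_pow_mul_pow (h.memY n) (h.memY' n) (p := 1) (q := 3) le_rfl).const_mul 4
  rw [← integral_const_mul, ← integral_const_mul, ← integral_const_mul, ← integral_add' i1 i31,
    ← integral_add' (i1.add i31) i22, ← integral_add' ((i1.add i31).add i22) i13,
    ← integral_add' (((i1.add i31).add i22).add i13) i2]
  exact integral_congr_ae (Eventually.of_forall fun ω => by simp only [Pi.add_apply]; ring)

lemma integral_sum_pow_three (h : MomentSplitting P S u r δ Y' ζ) (n : ℕ) :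
    ∫ ω, (S (u n) ω + δ n ω + Y' n ω) ^ 3 ∂P =
      (∫ ω, (S (u n) ω + δ n ω) ^ 3 ∂P) + 3 * (∫ ω, (S (u n) ω + δ n ω) ^ 2 * Y' n ω ^ 1 ∂P) +
      3 * (∫ ω, (S (u n) ω + δ n ω) ^ 1 * Y' n ω ^ 2 ∂P) + ∫ ω, Y' n ω ^ 3 ∂P := by
  have i1 := integrable_pow_of_memLp (h.memY n) (p := 3) (by norm_num)
  have i2 := integrable_pow_of_memLp (h.memY' n) (p := 3) (by norm_num)
  have i21 :=
    (integrable_pow_mul_pow (h.memY n) (h.memY' n) (p := 2) (q := 1) (by norm_num)).const_mul 3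
  have i12 :=
    (integrable_pow_mul_pow (h.memY n) (h.memY' n) (p := 1) (q := 2) (by norm_num)).const_mul 3
  rw [← integral_const_mul, ← integral_const_mul, ← integral_add' i1 i21,
    ← integral_add' (i1.add i21) i12, ← integral_add' ((i1.add i21).add i12) i2]
  exact integral_congr_ae (Eventually.of_forall fun ω => by simp only [Pi.add_apply]; ring)

lemma tendsto_mixed_two_two (h : MomentSplitting P S u r δ Y' ζ) :
    Tendsto (fun n => ∫ ω, (S (u n) ω + δ n ω) ^ 2 * Y' n ω ^ 2 ∂P) atTop (𝓝 1) := by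
  simpa using (h.mixed 2 2 (by norm_num) (by norm_num) (by norm_num)).add
    (h.tendsto_second.mul h.tendsto_second')

lemma tendsto_r_pow_four (h : MomentSplitting P S u r δ Y' ζ) :
    Tendsto (fun n => r n ^ 4) atTop (𝓝 (1 / 4)) := by
  have := h.tendsto_r.pow 4
  rwa [show ((√2)⁻¹ : ℝ) ^ 4 = 1 / 4 by
    rw [inv_pow, show (4 : ℕ) = 2 * 2 from rfl, pow_mul, Real.sq_sqrt (by norm_num)]; norm_num]
    at this

/-- The fourth moments of `S n` are bounded. -/
lemma exists_forall_integral_pow_four_le (h : MomentSplitting P S u r δ Y' ζ) :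
    ∃ B, ∀ n, ∫ ω, S n ω ^ 4 ∂P ≤ B := by
  -- The limiting factor is `2 / 4`. With the error terms at `1 / 100`, the estimates below give
  -- `0.26 * (2.2 * a + 8)`, so `3 / 4` and `10` leave ample room.
  refine exists_forall_le_of_recursion (c := 3 / 4) (K := 10) (by norm_num) (by norm_num) h.lt ?_
  obtain ⟨C, hC0, hC⟩ := exists_abs_integral_add_pow_sub_le (P := P) (τ := 1 / 100) (by norm_num)
  have hsmall : ∀ {x : ℕ → ℝ}, Tendsto x atTop (𝓝 0) → ∀ᶠ n in atTop, |x n| ≤ 1 / 100 :=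
    fun hx => ((tendsto_zero_iff_abs_tendsto_zero _).1 hx).eventually_le_const (by norm_num)
  have hCδ : Tendsto (fun n => C * ∫ ω, δ n ω ^ 4 ∂P) atTop (𝓝 0) := by
    simpa using h.tendsto_δ.const_mul C
  have hCζ : Tendsto (fun n => C * ∫ ω, ζ n ω ^ 4 ∂P) atTop (𝓝 0) := by
    simpa using h.tendsto_ζ.const_mul C
  filter_upwards [hsmall hCδ, hsmall hCζ, hsmall (h.moment 4 le_rfl),
    hsmall (h.mixed 3 1 (by norm_num) (by norm_num) le_rfl),
    hsmall (h.mixed 1 3 (by norm_num) (by norm_num) le_rfl), hsmall h.tendsto_first,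
    hsmall h.tendsto_first', h.tendsto_mixed_two_two.eventually_le_const (show (1 : ℝ) < 1.01 by
      norm_num), h.integral_pow_eq 4,
    h.tendsto_r_pow_four.eventually_le_const (show (1 / 4 : ℝ) < 0.26 by norm_num)]
    with n e1 e2 e3 e4 e5 e6 e7 e8 e9 e10
  rw [e9]
  have b1 := hC 4 le_rfl _ _ (h.memS (u n)) (h.memδ n)
  have b2 := hC 4 le_rfl _ _ (h.memYY' n) (h.memζ n)
  have b3 := abs_integral_pow_three_le (h.memY n)
  have b4 := abs_integral_pow_three_le (h.memY' n)
  have hA := h.integral_sum_pow_four n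
  have nn : ∀ f : Ω → ℝ, 0 ≤ ∫ ω, f ω ^ 4 ∂P := fun f =>
    integral_nonneg fun ω => by positivity
  have n1 := nn (S (u n))
  have n2 := nn fun ω => S (u n) ω + δ n ω + Y' n ω + ζ n ω
  have n3 := nn fun ω => S (u n) ω + δ n ω
  have n4 := nn (Y' n)
  set a := ∫ ω, S (u n) ω ^ 4 ∂P
  set E := ∫ ω, (S (u n) ω + δ n ω + Y' n ω + ζ n ω) ^ 4 ∂P
  set A := ∫ ω, (S (u n) ω + δ n ω + Y' n ω) ^ 4 ∂P
  set x := ∫ ω, (S (u n) ω + δ n ω) ^ 4 ∂P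
  set y := ∫ ω, Y' n ω ^ 4 ∂P
  set x3 := ∫ ω, (S (u n) ω + δ n ω) ^ 3 ∂P
  set y3 := ∫ ω, Y' n ω ^ 3 ∂P
  set x1 := ∫ ω, (S (u n) ω + δ n ω) ^ 1 ∂P
  set y1 := ∫ ω, Y' n ω ^ 1 ∂P
  set m31 := ∫ ω, (S (u n) ω + δ n ω) ^ 3 * Y' n ω ^ 1 ∂P
  set m13 := ∫ ω, (S (u n) ω + δ n ω) ^ 1 * Y' n ω ^ 3 ∂P
  -- Third moments are not known to be bounded here, but a small first moment turns the product into
  -- a small multiple of the fourth moment.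
  have p1 : |x3 * y1| ≤ (1 + x) * (1 / 100) := by rw [abs_mul]; gcongr
  have p2 : |x1 * y3| ≤ 1 / 100 * (1 + y) := by rw [abs_mul]; gcongr
  rw [abs_le] at e1 e2 e3 e4 e5 b1 b2 p1 p2
  have hx : x ≤ 1.01 * a + 0.02 := by linarith
  have hE : E ≤ 2.2 * a + 8 := by linarith
  calc r n ^ 4 * E ≤ 0.26 * E := by gcongr
    _ ≤ _ := by linarith

lemma tendsto_first_moment_sub (h : MomentSplitting P S u r δ Y' ζ) {p : ℕ} (hp : p ≤ 4) :
    Tendsto (fun n => (∫ ω, (S (u n) ω + δ n ω) ^ p ∂P) - ∫ ω, S (u n) ω ^ p ∂P) atTop (𝓝 0) := by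
  obtain ⟨B, hB⟩ := h.exists_forall_integral_pow_four_le
  exact tendsto_integral_add_pow_sub hp (fun n => h.memS (u n)) h.memδ
    (Eventually.of_forall fun n => hB (u n)) h.tendsto_δ

lemma exists_eventually_le (h : MomentSplitting P S u r δ Y' ζ) :
    ∃ B, 0 ≤ B ∧ ∀ᶠ n in atTop, (∫ ω, (S (u n) ω + δ n ω) ^ 4 ∂P) ≤ B ∧
      (∫ ω, Y' n ω ^ 4 ∂P) ≤ B := by
  obtain ⟨B, hB⟩ := h.exists_forall_integral_pow_four_le
  have hB0 : 0 ≤ B := (integral_nonneg fun ω => by positivity).trans (hB 0)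
  refine ⟨B + 2, by linarith, ?_⟩
  filter_upwards [((tendsto_zero_iff_abs_tendsto_zero _).1
      (h.tendsto_first_moment_sub le_rfl)).eventually_le_const one_pos,
    ((tendsto_zero_iff_abs_tendsto_zero _).1 (h.moment 4 le_rfl)).eventually_le_const one_pos]
    with n h1 h2
  have := hB (u n)
  simp only [Function.comp_apply, abs_le] at h1 h2
  constructor <;> linarith

lemma tendsto_mixed_three_one (h : MomentSplitting P S u r δ Y' ζ) :
    Tendsto (fun n => ∫ ω, (S (u n) ω + δ n ω) ^ 3 * Y' n ω ^ 1 ∂P) atTop (𝓝 0) := by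
  obtain ⟨B, -, hB⟩ := h.exists_eventually_le
  have := tendsto_mul_zero_of_abs_le (K := 1 + B) (hB.mono fun n hn =>
    (abs_integral_pow_three_le (h.memY n)).trans (by linarith [hn.1])) h.tendsto_first'
  simpa using (h.mixed 3 1 (by norm_num) (by norm_num) le_rfl).add this

lemma tendsto_mixed_one_three (h : MomentSplitting P S u r δ Y' ζ) :
    Tendsto (fun n => ∫ ω, (S (u n) ω + δ n ω) ^ 1 * Y' n ω ^ 3 ∂P) atTop (𝓝 0) := by
  obtain ⟨B, -, hB⟩ := h.exists_eventually_le
  have := tendsto_mul_zero_of_abs_le (K := 1 + B) (hB.mono fun n hn =>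
    (abs_integral_pow_three_le (h.memY' n)).trans (by linarith [hn.2])) h.tendsto_first
  have h' := (h.mixed 1 3 (by norm_num) (by norm_num) le_rfl).add this
  rw [add_zero] at h'
  exact h'.congr fun n => by ring

/-- The `(3,1)` and `(1,3)` terms vanish with the first moments, the `(2,2)` term contributes `6 * 1
* 1`, and both pure fourth moments are asymptotically that of `S (u n)`. -/
lemma tendsto_sum_pow_four_sub (h : MomentSplitting P S u r δ Y' ζ) :
    Tendsto (fun n => (∫ ω, (S (u n) ω + δ n ω + Y' n ω) ^ 4 ∂P) - 2 * ∫ ω, S (u n) ω ^ 4 ∂P)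
      atTop (𝓝 6) := by
  have := ((((h.tendsto_first_moment_sub le_rfl).const_mul 2).sub (h.moment 4 le_rfl)).add
    ((h.tendsto_mixed_three_one.add h.tendsto_mixed_one_three).const_mul 4)).add
    (h.tendsto_mixed_two_two.const_mul 6)
  rw [show (2 : ℝ) * 0 - 0 + 4 * (0 + 0) + 6 * 1 = 6 by norm_num] at this
  refine this.congr fun n => ?_
  rw [h.integral_sum_pow_four]
  ring

/-- Each mixed term factors asymptotically into a first moment, which vanishes, and a second moment,
which converges. -/
lemma tendsto_sum_pow_three_sub (h : MomentSplitting P S u r δ Y' ζ) :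
    Tendsto (fun n => (∫ ω, (S (u n) ω + δ n ω + Y' n ω) ^ 3 ∂P) - 2 * ∫ ω, S (u n) ω ^ 3 ∂P)
      atTop (𝓝 0) := by
  have h21 := (h.mixed 2 1 (by norm_num) (by norm_num) (by norm_num)).add
    (h.tendsto_second.mul h.tendsto_first')
  have h12 := (h.mixed 1 2 (by norm_num) (by norm_num) (by norm_num)).add
    (h.tendsto_first.mul h.tendsto_second')
  have := (((h.tendsto_first_moment_sub (p := 3) (by norm_num)).const_mul 2).sub
    (h.moment 3 (by norm_num))).add ((h21.add h12).const_mul 3)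
  simp only [mul_zero, zero_mul, add_zero, sub_zero] at this
  refine this.congr fun n => ?_
  rw [h.integral_sum_pow_three]
  ring

lemma tendsto_perturbed_sum_sub (h : MomentSplitting P S u r δ Y' ζ) {p : ℕ} (hp : p ≤ 4) :
    Tendsto (fun n => (∫ ω, (S (u n) ω + δ n ω + Y' n ω + ζ n ω) ^ p ∂P) -
      ∫ ω, (S (u n) ω + δ n ω + Y' n ω) ^ p ∂P) atTop (𝓝 0) := by
  obtain ⟨B, hB⟩ := h.exists_forall_integral_pow_four_le
  refine tendsto_integral_add_pow_sub (K := 2 * B + 7) hp h.memYY' h.memζ ?_ h.tendsto_ζ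
  filter_upwards [h.tendsto_sum_pow_four_sub.eventually_le_const (show (6 : ℝ) < 7 by norm_num)]
    with n hn
  linarith [hB (u n)]

/-- If `r → ρ` and `E n - b n → c` with `b` bounded, then `r n * E n - ρ * b n → ρ * c`. -/
lemma _root_.BlockCLT.tendsto_mul_sub_of_bounded {r E b : ℕ → ℝ} {ρ c K : ℝ}
    (hr : Tendsto r atTop (𝓝 ρ)) (hE : Tendsto (fun n => E n - b n) atTop (𝓝 c))
    (hb : ∀ n, |b n| ≤ K) : Tendsto (fun n => r n * E n - ρ * b n) atTop (𝓝 (ρ * c)) := by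
  have h1 : Tendsto (fun n => r n - ρ) atTop (𝓝 0) := by simpa using hr.sub_const ρ
  have := (hr.mul hE).add (tendsto_mul_zero_of_abs_le (Eventually.of_forall hb) h1)
  rw [add_zero] at this
  exact this.congr fun n => by ring

/-- The fourth moments of `S n` tend to `3`. -/
lemma tendsto_integral_pow_four (h : MomentSplitting P S u r δ Y' ζ) :
    Tendsto (fun n => ∫ ω, S n ω ^ 4 ∂P) atTop (𝓝 3) := by
  obtain ⟨B, hB⟩ := h.exists_forall_integral_pow_four_le
  have h0 : ∀ n, 0 ≤ ∫ ω, S n ω ^ 4 ∂P := fun n => integral_nonneg fun ω => by positivity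
  have hE : Tendsto (fun n => (∫ ω, (S (u n) ω + δ n ω + Y' n ω + ζ n ω) ^ 4 ∂P) -
      2 * ∫ ω, S (u n) ω ^ 4 ∂P) atTop (𝓝 6) := by
    have := (h.tendsto_perturbed_sum_sub le_rfl).add h.tendsto_sum_pow_four_sub
    rw [zero_add] at this
    exact this.congr fun n => by ring
  have hrec := tendsto_mul_sub_of_bounded (K := 2 * B) h.tendsto_r_pow_four hE fun n => by
    rw [abs_of_nonneg (by linarith [h0 (u n)])]
    linarith [hB (u n)]
  -- `3` is the fixed point of `a ↦ (2 a + 6) / 4`; centring there makes the recursion homogeneous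
  -- with factor `1 / 2`.
  have key : Tendsto (fun n => (∫ ω, S n ω ^ 4 ∂P) - 3) atTop (𝓝 0) := by
    refine tendsto_zero_of_recursion (c := 1 / 2) (B := B + 3) h.tendsto_u
      (by rw [abs_of_pos] <;> norm_num) (fun n => ?_) ?_
    · rw [abs_le]
      constructor <;> linarith [h0 n, hB n]
    · have := hrec.sub_const (3 / 2)
      norm_num at this
      refine this.congr' ?_
      filter_upwards [h.integral_pow_eq 4] with n hn
      rw [hn]
      ring
  simpa using key.add_const 3

/-- The third moments of `S n` tend to `0`. -/
lemma tendsto_integral_pow_three (h : MomentSplitting P S u r δ Y' ζ) :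
    Tendsto (fun n => ∫ ω, S n ω ^ 3 ∂P) atTop (𝓝 0) := by
  obtain ⟨B, hB⟩ := h.exists_forall_integral_pow_four_le
  have hB3 : ∀ n, |∫ ω, S n ω ^ 3 ∂P| ≤ 1 + B := fun n =>
    (abs_integral_pow_three_le (h.memS n)).trans (by linarith [hB n])
  have hE : Tendsto (fun n => (∫ ω, (S (u n) ω + δ n ω + Y' n ω + ζ n ω) ^ 3 ∂P) -
      2 * ∫ ω, S (u n) ω ^ 3 ∂P) atTop (𝓝 0) := by
    have := (h.tendsto_perturbed_sum_sub (p := 3) (by norm_num)).add h.tendsto_sum_pow_three_sub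
    rw [zero_add] at this
    exact this.congr fun n => by ring
  have hrec := tendsto_mul_sub_of_bounded (K := 2 * (1 + B)) (h.tendsto_r.pow 3) hE fun n => by
    rw [abs_mul, abs_two]
    linarith [hB3 (u n)]
  -- The contraction factor for third moments: two blocks, each scaled by `(√2)⁻¹ ^ 3`.
  have h2 : (√2)⁻¹ ^ 3 * 2 = (√2)⁻¹ := by
    have : (√2) ^ 2 = 2 := Real.sq_sqrt (by norm_num)
    have h0 : √2 ≠ 0 := by positivity
    field_simp
    linarith
  refine tendsto_zero_of_recursion (c := (√2)⁻¹) h.tendsto_u ?_ hB3 ?_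
  · rw [abs_of_pos (by positivity)]
    exact inv_lt_one_of_one_lt₀ (by
      rw [Real.lt_sqrt] <;> norm_num)
  · rw [mul_zero] at hrec
    refine hrec.congr' ?_
    filter_upwards [h.integral_pow_eq 3] with n hn
    rw [hn, ← mul_assoc, h2]

end MomentSplitting
end
end BlockCLT

/-! ### The recursion for characteristic functions and the Gaussian limit -/

namespace BlockCLT

section

variable {Ω : Type*} [MeasurableSpace Ω] {P : Measure Ω} [IsProbabilityMeasure P]

lemma norm_sub_le_of_sq {z w : ℂ} (hz : ‖z‖ ≤ 1) (hw : ‖w‖ ≤ 1) :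
    ‖z ^ 2 - w ^ 2‖ ≤ 2 * ‖z - w‖ := by
  rw [sq_sub_sq, norm_mul]
  exact mul_le_mul_of_nonneg_right ((norm_add_le _ _).trans (by linarith)) (norm_nonneg _)

/-- A standardized sequence whose characteristic functions asymptotically satisfy
`φ n t = φ (u n) (t / √2) ^ 2` is asymptotically Gaussian. -/
lemma tendsto_integral_exp_of_recursion {S : ℕ → Ω → ℝ} {u : ℕ → ℕ} {B : ℝ}
    (hS : ∀ n, MemLp (S n) 4 P) (hmean : ∀ n, 1 ≤ n → ∫ ω, S n ω ∂P = 0)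
    (hsq : ∀ n, 1 ≤ n → ∫ ω, S n ω ^ 2 ∂P = 1) (hB : ∀ n, ∫ ω, S n ω ^ 4 ∂P ≤ B)
    (hu : Tendsto u atTop atTop)
    (h : ∀ t : ℝ, Tendsto (fun n => (∫ ω, Complex.exp ((t * S n ω : ℝ) * Complex.I) ∂P) -
      (∫ ω, Complex.exp ((t / √2 * S (u n) ω : ℝ) * Complex.I) ∂P) ^ 2) atTop (𝓝 0)) (t : ℝ) :
    Tendsto (fun n => ∫ ω, Complex.exp ((t * S n ω : ℝ) * Complex.I) ∂P) atTop
      (𝓝 (charFun (gaussianReal 0 1) t)) := by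
  set g : ℝ → ℂ := fun t => charFun (gaussianReal 0 1) t with hg
  have hg2 : ∀ t, g t = g (t / √2) ^ 2 := fun t => by
    simp only [hg, charFun_gaussianReal, ← Complex.exp_nat_mul]
    congr 1
    have h2 : ((√2 : ℝ) : ℂ) ^ 2 = 2 := by
      rw [← Complex.ofReal_pow, Real.sq_sqrt (by norm_num)]; norm_num
    push_cast
    rw [div_pow, h2]
    ring
  have hg1 : ∀ t, ‖g t‖ ≤ 1 := norm_charFun_le_one
  -- The expansion for standardized variables is applied to the identity under the Gaussian law
  -- itself.
  obtain ⟨D, hD0, hD⟩ : ∃ D : ℝ, 0 ≤ D ∧ ∀ s, ‖g s - (1 - s ^ 2 / 2 : ℝ)‖ ≤ D * |s| ^ 3 := by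
    have hmem : MemLp (id : ℝ → ℝ) 4 (gaussianReal 0 1) := memLp_id_gaussianReal 4
    refine ⟨4 * (1 + ∫ x, id x ^ 4 ∂(gaussianReal 0 1)), ?_, fun s => ?_⟩
    · have : 0 ≤ ∫ x : ℝ, id x ^ 4 ∂(gaussianReal 0 1) :=
        integral_nonneg fun x => by positivity
      positivity
    have h0 : ∫ x, id x ∂(gaussianReal 0 1) = 0 := integral_id_gaussianReal
    have h1 : ∫ x, id x ^ 2 ∂(gaussianReal 0 1) = 1 := by
      have := variance_id_gaussianReal (μ := 0) (v := 1)
      rw [variance_eq_sub (memLp_id_gaussianReal 2), h0] at this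
      simpa using this
    have := norm_integral_exp_sub_le_of_standardized hmem h0 h1 s
    simpa [hg, charFun_apply_real] using this
  set φ : ℕ → ℝ → ℂ := fun n t => ∫ ω, Complex.exp ((t * S n ω : ℝ) * Complex.I) ∂P with hφ
  have hφ1 : ∀ n t, ‖φ n t‖ ≤ 1 := fun n t => norm_integral_exp_le_one fun ω => t * S n ω
  set C := 4 * (1 + B) + D with hC
  have hφ3 : ∀ n, 1 ≤ n → ∀ s, ‖φ n s - g s‖ ≤ C * |s| ^ 3 := fun n hn s => by
    have h1 := norm_integral_exp_sub_le_of_standardized (hS n) (hmean n hn) (hsq n hn) s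
    have h2 : 4 * (1 + ∫ ω, S n ω ^ 4 ∂P) * |s| ^ 3 ≤ 4 * (1 + B) * |s| ^ 3 := by
      gcongr; exact hB n
    calc ‖φ n s - g s‖ ≤ ‖φ n s - (1 - s ^ 2 / 2 : ℝ)‖ + ‖(1 - s ^ 2 / 2 : ℝ) - g s‖ :=
          norm_sub_le_norm_sub_add_norm_sub _ _ _
      _ ≤ 4 * (1 + B) * |s| ^ 3 + D * |s| ^ 3 :=
          add_le_add (h1.trans h2) (by rw [norm_sub_rev]; exact hD s)
      _ = _ := by rw [hC]; ring
  -- Each step doubles the error and divides the argument by `√2`. The cubic bound beats the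
  -- doubling, since `2 ^ k * (√2 ^ k)⁻¹ ^ 3 = (√2)⁻¹ ^ k`.
  have key : ∀ k : ℕ, ∀ t η : ℝ, 0 < η →
      ∀ᶠ n in atTop, ‖φ n t - g t‖ ≤ 2 ^ k * (C * |t / √2 ^ k| ^ 3) + η := by
    intro k
    induction k with
    | zero =>
      intro t η hη
      filter_upwards [eventually_ge_atTop 1] with n hn
      simpa using (hφ3 n hn t).trans (by linarith)
    | succ k ih =>
      intro t η hη
      filter_upwards [hu.eventually (ih (t / √2) (η / 4) (by positivity)),
        (Metric.tendsto_nhds.1 (h t)) (η / 2) (half_pos hη)] with n h1 h2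
      rw [dist_zero_right] at h2
      have h3 : ‖φ n t - g t‖ ≤ ‖φ n t - φ (u n) (t / √2) ^ 2‖ +
          2 * ‖φ (u n) (t / √2) - g (t / √2)‖ := by
        rw [hg2 t]
        exact (norm_sub_le_norm_sub_add_norm_sub _ _ _).trans
          (add_le_add_right (norm_sub_le_of_sq (hφ1 _ _) (hg1 _)) _)
      rw [div_div, ← pow_succ'] at h1
      rw [pow_succ 2 k]
      change ‖φ n t - φ (u n) (t / √2) ^ 2‖ < η / 2 at h2
      linarith
  have hlim : Tendsto (fun k : ℕ => (2 : ℝ) ^ k * (C * |t / √2 ^ k| ^ 3)) atTop (𝓝 0) := by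
    have h2 : Tendsto (fun k : ℕ => ((√2)⁻¹ : ℝ) ^ k * (C * |t| ^ 3)) atTop (𝓝 0) := by
      simpa using (tendsto_pow_atTop_nhds_zero_of_lt_one (by positivity)
        (inv_lt_one_of_one_lt₀ (by rw [Real.lt_sqrt] <;> norm_num))).mul_const (C * |t| ^ 3)
    refine h2.congr fun k => ?_
    have h3 : (2 : ℝ) ^ k = (√2 ^ k) ^ 2 := by
      rw [← pow_mul, mul_comm k 2, pow_mul, Real.sq_sqrt (by norm_num)]
    have h4 : (0 : ℝ) < √2 ^ k := by positivity
    rw [h3, abs_div, abs_of_pos h4, div_pow, inv_pow]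
    field_simp
  rw [Metric.tendsto_nhds]
  intro η hη
  obtain ⟨k, hk⟩ := (hlim.eventually_lt_const (half_pos hη)).exists
  filter_upwards [key k t (η / 2) (half_pos hη)] with n hn
  rw [dist_eq_norm]
  exact hn.trans_lt (by linarith)

/-- Convergence in distribution from convergence of the integrals of complex exponentials. -/
lemma tendstoInDistribution_gaussian_of_exp {S : ℕ → Ω → ℝ} (hS : ∀ n, AEMeasurable (S n) P)
    (h : ∀ t : ℝ, Tendsto (fun n => ∫ ω, Complex.exp ((t * S n ω : ℝ) * Complex.I) ∂P) atTop
      (𝓝 (charFun (gaussianReal 0 1) t))) :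
    TendstoInDistribution S atTop (id : ℝ → ℝ) (fun _ => P) (gaussianReal 0 1) where
  forall_aemeasurable := hS
  aemeasurable_limit := aemeasurable_id
  tendsto := by
    refine ProbabilityMeasure.tendsto_iff_tendsto_charFun.2 fun t => ?_
    simp only [ProbabilityMeasure.coe_mk, Measure.map_id]
    refine (h t).congr fun n => ?_
    rw [charFun_apply_real, integral_map (hS n)
      (by fun_prop : Continuous fun x : ℝ => Complex.exp (t * x * Complex.I)).aestronglyMeasurable]
    simp

/-- The hypotheses on the blocks under which the characteristic functions satisfy the recursion:
`S n = r n (S (u n) + ξ n + S' n)`, with `ξ`, `ε`, `ε'` small in `L²` and the laws of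
`Y = S (u n) + ε n` and `Y' = S' n + ε' n`, divided by the norm of `Y`, asymptotically equal and
independent on cells. -/
lemma tendsto_integral_exp_sub_sq_of_cells {S S' ξ ε ε' : ℕ → Ω → ℝ} {u : ℕ → ℕ} {r : ℕ → ℝ}
    {K : ℝ} (hS : ∀ n, MemLp (S n) 2 P) (hS' : ∀ n, MemLp (S' n) 2 P) (hξ : ∀ n, MemLp (ξ n) 2 P)
    (hε : ∀ n, MemLp (ε n) 2 P) (hε' : ∀ n, MemLp (ε' n) 2 P)
    (hsq : ∀ n, ∫ ω, S (u n) ω ^ 2 ∂P = 1) (hK : ∀ᶠ n in atTop, ∫ ω, S' n ω ^ 2 ∂P ≤ K)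
    (hξ0 : Tendsto (fun n => ∫ ω, ξ n ω ^ 2 ∂P) atTop (𝓝 0))
    (hε0 : Tendsto (fun n => ∫ ω, ε n ω ^ 2 ∂P) atTop (𝓝 0))
    (hε0' : Tendsto (fun n => ∫ ω, ε' n ω ^ 2 ∂P) atTop (𝓝 0))
    (hr : Tendsto r atTop (𝓝 (√2)⁻¹))
    (heq : ∀ᶠ n in atTop, ∀ ω, S n ω = r n * (S (u n) ω + ξ n ω + S' n ω))
    {c : ℕ → ℝ} (hc : ∀ n, c n = (√(∫ ω, (S (u n) ω + ε n ω) ^ 2 ∂P))⁻¹)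
    (hcell : ∀ (k : ℕ) (j : ℤ), Tendsto (fun n =>
      P.real {ω | c n * (S (u n) ω + ε n ω) ∈ cell k j} -
        P.real {ω | c n * (S' n ω + ε' n ω) ∈ cell k j}) atTop (𝓝 0))
    (hind : ∀ (k : ℕ) (j j' : ℤ), Tendsto (fun n =>
      P.real ({ω | c n * (S (u n) ω + ε n ω) ∈ cell k j} ∩
          {ω | c n * (S' n ω + ε' n ω) ∈ cell k j'}) -
        P.real {ω | c n * (S (u n) ω + ε n ω) ∈ cell k j} *
          P.real {ω | c n * (S' n ω + ε' n ω) ∈ cell k j'}) atTop (𝓝 0)) (t : ℝ) :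
    Tendsto (fun n => (∫ ω, Complex.exp ((t * S n ω : ℝ) * Complex.I) ∂P) -
      (∫ ω, Complex.exp ((t / √2 * S (u n) ω : ℝ) * Complex.I) ∂P) ^ 2) atTop (𝓝 0) := by
  set s := t / √2 with hs
  have hY : Tendsto (fun n => ∫ ω, (S (u n) ω + ε n ω) ^ 2 ∂P) atTop (𝓝 1) := by
    have := (tendsto_integral_add_sq_sub (K := 1) (fun n => hS (u n)) hε
      (Eventually.of_forall fun n => (hsq n).le) hε0).add_const 1
    simpa [hsq] using this
  -- The normalization inside the cells is harmless in the limit, as `S (u n)` already has norm `1`.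
  have hc1 : Tendsto c atTop (𝓝 1) := by
    have := hY.sqrt.inv₀ (by norm_num)
    simp only [Real.sqrt_one, inv_one] at this
    exact this.congr fun n => (hc n).symm
  have hY' : ∀ᶠ n in atTop, ∫ ω, (S' n ω + ε' n ω) ^ 2 ∂P ≤ K + 1 := by
    filter_upwards [(tendsto_integral_add_sq_sub hS' hε' hK hε0').eventually_le_const one_pos, hK]
      with n h1 h2
    linarith
  have hc2 : Tendsto (fun n => c n ^ 2) atTop (𝓝 1) := by simpa using hc1.pow 2
  have hmul : ∀ {Z : ℕ → Ω → ℝ} {M : ℝ}, 0 ≤ M → (∀ᶠ n in atTop, ∫ ω, Z n ω ^ 2 ∂P ≤ M) →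
      ∀ᶠ n in atTop, ∫ ω, (c n * Z n ω) ^ 2 ∂P ≤ 2 * M := by
    intro Z M hM hZ
    filter_upwards [hZ, hc2.eventually_le_const (show (1 : ℝ) < 2 by norm_num)] with n h1 h2
    simp only [mul_pow]
    rw [integral_const_mul]
    exact mul_le_mul h2 h1 (integral_nonneg fun ω => sq_nonneg _) (by norm_num)
  have hZ2 := hmul (Z := fun n ω => S (u n) ω + ε n ω) (M := |K| + 2) (by positivity)
    (hY.eventually_le_const (by linarith [abs_nonneg K]))
  have hZ2' := hmul (Z := fun n ω => S' n ω + ε' n ω) (M := |K| + 2) (by positivity)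
    (hY'.mono fun n hn => hn.trans (by linarith [le_abs_self K]))
  have hmZ : ∀ n, MemLp (fun ω => c n * (S (u n) ω + ε n ω)) 2 P := fun n =>
    ((hS (u n)).add (hε n)).const_mul _
  have hmZ' : ∀ n, MemLp (fun ω => c n * (S' n ω + ε' n ω)) 2 P := fun n =>
    ((hS' n).add (hε' n)).const_mul _
  have main := tendsto_integral_exp_add_sub_sq hmZ hmZ' hZ2 hZ2' hcell hind s
  have habs0 : ∀ {W : ℕ → Ω → ℝ}, (∀ n, MemLp (W n) 2 P) →
      Tendsto (fun n => ∫ ω, W n ω ^ 2 ∂P) atTop (𝓝 0) →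
      Tendsto (fun n => ∫ ω, |W n ω| ∂P) atTop (𝓝 0) := fun hW hW0 =>
    squeeze_zero (fun n => integral_nonneg fun ω => abs_nonneg _)
      (fun n => integral_abs_le_sqrt (hW n)) (by simpa using hW0.sqrt)
  have hiS := fun n => ((hS n).integrable (by norm_num)).abs
  have hiS' := fun n => ((hS' n).integrable (by norm_num)).abs
  have hiξ := fun n => ((hξ n).integrable (by norm_num)).abs
  have hiε := fun n => ((hε n).integrable (by norm_num)).abs
  have hiε' := fun n => ((hε' n).integrable (by norm_num)).abs
  have hbS : ∀ n, ∫ ω, |S (u n) ω| ∂P ≤ 1 := fun n =>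
    (integral_abs_le_sqrt (hS (u n))).trans (by rw [hsq]; simp)
  have hbS' : ∀ᶠ n in atTop, ∫ ω, |S' n ω| ∂P ≤ √K := hK.mono fun n hn =>
    (integral_abs_le_sqrt (hS' n)).trans (Real.sqrt_le_sqrt hn)
  have hsc : Tendsto (fun n => |s * c n|) atTop (𝓝 |s|) := by simpa using (hc1.const_mul s).abs
  -- The exponents differ by `(t r - s c) (S_u + S') + t r ξ - s c (ε + ε')`. Each part tends to `0`
  -- in `L¹`, because `t r` and `s c` both tend to `s = t / √2`.
  have hd1 : Tendsto (fun n => (∫ ω, Complex.exp ((t * S n ω : ℝ) * Complex.I) ∂P) -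
      ∫ ω, Complex.exp ((s * (c n * (S (u n) ω + ε n ω) + c n * (S' n ω + ε' n ω)) : ℝ) *
        Complex.I) ∂P) atTop (𝓝 0) := by
    have hdiff : Tendsto (fun n => |t * r n - s * c n|) atTop (𝓝 0) := by
      have := ((hr.const_mul t).sub (hc1.const_mul s)).abs
      rwa [hs, mul_one, div_eq_mul_inv, sub_self, abs_zero] at this
    have hb : Tendsto (fun n => (1 + √K) * |t * r n - s * c n| + |t * r n| * ∫ ω, |ξ n ω| ∂P +
        |s * c n| * ((∫ ω, |ε n ω| ∂P) + ∫ ω, |ε' n ω| ∂P)) atTop (𝓝 0) := by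
      have := ((hdiff.const_mul (1 + √K)).add ((hr.const_mul t).abs.mul (habs0 hξ hξ0))).add
        (hsc.mul ((habs0 hε hε0).add (habs0 hε' hε0')))
      simpa using this
    refine squeeze_zero_norm' ?_ hb
    filter_upwards [heq, hbS'] with n hn hn'
    have i1 : Integrable (fun ω => |t * r n - s * c n| * (|S (u n) ω| + |S' n ω|)) P :=
      ((hiS _).add (hiS' n)).const_mul _
    have i2 : Integrable (fun ω => |t * r n - s * c n| * (|S (u n) ω| + |S' n ω|) +
        |t * r n| * |ξ n ω|) P := i1.add ((hiξ n).const_mul _)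
    have i3 : Integrable (fun ω => |s * c n| * (|ε n ω| + |ε' n ω|)) P :=
      ((hiε n).add (hiε' n)).const_mul _
    refine (norm_integral_exp_sub_le ((hS n).1.const_mul t) (((hmZ n).1.add (hmZ' n).1).const_mul s)
      ((((hS n).const_mul t).sub (((hmZ n).add (hmZ' n)).const_mul s)).integrable
        (by norm_num))).trans ?_
    calc _ ≤ ∫ ω, (|t * r n - s * c n| * (|S (u n) ω| + |S' n ω|) +
        |t * r n| * |ξ n ω| + |s * c n| * (|ε n ω| + |ε' n ω|)) ∂P := by
          refine integral_mono
            ((((hS n).const_mul t).sub (((hmZ n).add (hmZ' n)).const_mul s)).integrable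
              (by norm_num)).abs (i2.add i3) fun ω => ?_
          change |t * S n ω - s * (c n * (S (u n) ω + ε n ω) + c n * (S' n ω + ε' n ω))| ≤ _
          have : t * S n ω - s * (c n * (S (u n) ω + ε n ω) + c n * (S' n ω + ε' n ω)) =
              (t * r n - s * c n) * (S (u n) ω + S' n ω) + (t * r n) * ξ n ω -
                (s * c n) * (ε n ω + ε' n ω) := by rw [hn ω]; ring
          rw [this]
          refine (abs_sub _ _).trans (add_le_add ((abs_add_le _ _).trans (add_le_add ?_ ?_)) ?_)
          · rw [abs_mul]; gcongr; exact abs_add_le _ _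
          · rw [abs_mul]
          · rw [abs_mul]; gcongr; exact abs_add_le _ _
      _ = |t * r n - s * c n| * ((∫ ω, |S (u n) ω| ∂P) + ∫ ω, |S' n ω| ∂P) +
          |t * r n| * (∫ ω, |ξ n ω| ∂P) +
          |s * c n| * ((∫ ω, |ε n ω| ∂P) + ∫ ω, |ε' n ω| ∂P) := by
          rw [integral_add i2 i3, integral_add i1 ((hiξ n).const_mul _), integral_const_mul,
            integral_const_mul, integral_const_mul, integral_add (hiS _) (hiS' n),
            integral_add (hiε n) (hiε' n)]
      _ ≤ _ := by
          gcongr ?_ + _ + _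
          rw [mul_comm]
          gcongr
          exact hbS n
  have hd2 : Tendsto (fun n => (∫ ω, Complex.exp ((s * (c n * (S (u n) ω + ε n ω)) : ℝ) *
      Complex.I) ∂P) - ∫ ω, Complex.exp ((s * S (u n) ω : ℝ) * Complex.I) ∂P) atTop (𝓝 0) := by
    have hdiff : Tendsto (fun n => |s * c n - s|) atTop (𝓝 0) := by
      simpa using ((hc1.const_mul s).sub_const s).abs
    have hb : Tendsto (fun n => |s * c n - s| + |s * c n| * ∫ ω, |ε n ω| ∂P) atTop (𝓝 0) := by
      simpa using hdiff.add (hsc.mul (habs0 hε hε0))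
    refine squeeze_zero_norm (fun n => ?_) hb
    have hint : Integrable (fun ω => |s * c n - s| * |S (u n) ω| + |s * c n| * |ε n ω|) P :=
      ((hiS _).const_mul _).add ((hiε n).const_mul _)
    have hi := (((hmZ n).const_mul s).sub ((hS (u n)).const_mul s)).integrable (by norm_num)
    refine (norm_integral_exp_sub_le ((hmZ n).1.const_mul s) ((hS (u n)).1.const_mul s) hi).trans ?_
    calc _ ≤ ∫ ω, (|s * c n - s| * |S (u n) ω| + |s * c n| * |ε n ω|) ∂P := by
          refine integral_mono hi.abs hint fun ω => ?_
          change |s * (c n * (S (u n) ω + ε n ω)) - s * S (u n) ω| ≤ _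
          have : s * (c n * (S (u n) ω + ε n ω)) - s * S (u n) ω =
              (s * c n - s) * S (u n) ω + (s * c n) * ε n ω := by ring
          rw [this]
          refine (abs_add_le _ _).trans (le_of_eq ?_)
          rw [abs_mul, abs_mul (s * c n)]
      _ = |s * c n - s| * (∫ ω, |S (u n) ω| ∂P) + |s * c n| * ∫ ω, |ε n ω| ∂P := by
          rw [integral_add ((hiS _).const_mul _) ((hiε n).const_mul _), integral_const_mul,
            integral_const_mul]
      _ ≤ _ := by
          gcongr
          exact mul_le_of_le_one_right (abs_nonneg _) (hbS n)
  have hd3 : Tendsto (fun n => (∫ ω, Complex.exp ((s * (c n * (S (u n) ω + ε n ω)) : ℝ) *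
      Complex.I) ∂P) ^ 2 - (∫ ω, Complex.exp ((s * S (u n) ω : ℝ) * Complex.I) ∂P) ^ 2) atTop
      (𝓝 0) := by
    refine squeeze_zero_norm (fun n => norm_sub_le_of_sq (norm_integral_exp_le_one _)
      (norm_integral_exp_le_one _)) ?_
    simpa using hd2.norm.const_mul 2
  have := (hd1.add main).add hd3
  simp only [add_zero] at this
  exact this.congr fun n => by ring

end

end BlockCLT

/-! ### Block lengths and the decomposition of the sum -/

namespace BlockCLT

section HalfLen

variable {κ : ℕ → ℕ}

lemma bddAbove_halfLen_set (κ : ℕ → ℕ) (n : ℕ) : BddAbove {m : ℕ | 1 ≤ m ∧ 2 * m + κ m ≤ n} :=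
  ⟨n, fun m hm => by have := hm.2; omega⟩

/-- `m = 1` is admissible since `κ 1 = 0` and `n ≥ 2`, so the supremum is over a nonempty bounded
set and is attained. -/
lemma halfLen_mem (hκ : IsGapSequence κ) {n : ℕ} (hn : 2 ≤ n) :
    1 ≤ halfLen κ n ∧ 2 * halfLen κ n + κ (halfLen κ n) ≤ n := by
  rw [halfLen, if_neg (by omega)]
  exact Nat.sSup_mem (s := {m : ℕ | 1 ≤ m ∧ 2 * m + κ m ≤ n})
    ⟨1, le_rfl, by rw [hκ.one]; omega⟩ (bddAbove_halfLen_set κ n)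

lemma one_le_halfLen (hκ : IsGapSequence κ) (n : ℕ) : 1 ≤ halfLen κ n := by
  rcases le_or_gt n 1 with hn | hn
  · simp [halfLen, hn]
  · exact (halfLen_mem hκ hn).1

lemma halfLen_lt (hκ : IsGapSequence κ) {n : ℕ} (hn : 2 ≤ n) : halfLen κ n < n := by
  have := halfLen_mem hκ hn
  omega

lemma tendsto_halfLen (κ : ℕ → ℕ) : Tendsto (halfLen κ) atTop atTop := by
  refine tendsto_atTop.2 fun m => ?_
  -- Taking `m + 1` rather than `m` ensures both the condition `1 ≤ m + 1` of the set and `n > 1`,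
  -- away from the default branch.
  filter_upwards [eventually_ge_atTop (2 * (m + 1) + κ (m + 1))] with n hn
  rw [halfLen, if_neg (by omega)]
  exact (Nat.le_succ m).trans (le_csSup (bddAbove_halfLen_set κ n) ⟨by omega, hn⟩)

end HalfLen

lemma tendsto_zero_of_add {ι : Type*} {l : Filter ι} {x y : ι → ℝ} (hx : ∀ n, 0 ≤ x n)
    (hy : ∀ n, 0 ≤ y n) (h : Tendsto (fun n => x n + y n) l (𝓝 0)) :
    Tendsto x l (𝓝 0) ∧ Tendsto y l (𝓝 0) :=
  ⟨squeeze_zero hx (fun n => le_add_of_nonneg_right (hy n)) h,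
    squeeze_zero hy (fun n => le_add_of_nonneg_left (hx n)) h⟩

section

variable {Ω : Type*} [MeasurableSpace Ω] {P : Measure Ω} [IsProbabilityMeasure P]
  {X : ℕ → Ω → ℝ} {κ : ℕ → ℕ}

omit [IsProbabilityMeasure P] in
lemma memLp_sum_div (hX4 : ∀ n, 1 ≤ n → MemLp (X n) 4 P) (s : Finset ℕ) (hs : ∀ i ∈ s, 1 ≤ i)
    (c : ℝ) : MemLp (fun ω => (∑ i ∈ s, X i ω) / c) 4 P := by
  have h := (memLp_finsetSum s fun i hi => hX4 i (hs i hi)).const_mul c⁻¹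
  simpa [div_eq_inv_mul] using h

omit [IsProbabilityMeasure P] in
lemma memLp_normSum (hX4 : ∀ n, 1 ≤ n → MemLp (X n) 4 P) (n : ℕ) : MemLp (normSum P X n) 4 P :=
  memLp_sum_div hX4 _ (fun _ hi => (Finset.mem_Icc.1 hi).1) _

omit [IsProbabilityMeasure P] in
lemma memLp_middleBlock (hX4 : ∀ n, 1 ≤ n → MemLp (X n) 4 P) (n : ℕ) :
    MemLp (middleBlock P X κ n) 4 P :=
  memLp_sum_div hX4 _ (fun _ hi => by have := (Finset.mem_Ioc.1 hi).1; omega) _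

omit [IsProbabilityMeasure P] in
lemma memLp_lastBlock (hX4 : ∀ n, 1 ≤ n → MemLp (X n) 4 P) (n : ℕ) :
    MemLp (lastBlock P X κ n) 4 P :=
  memLp_sum_div hX4 _ (fun _ hi => by have := (Finset.mem_Ioc.1 hi).1; omega) _

lemma integral_sum_eq_zero (hmean : ∀ n, 1 ≤ n → ∫ ω, X n ω ∂P = 0)
    (hX4 : ∀ n, 1 ≤ n → MemLp (X n) 4 P) (n : ℕ) : ∫ ω, ∑ i ∈ Finset.Icc 1 n, X i ω ∂P = 0 := by
  rw [integral_finsetSum _ fun i hi =>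
    (hX4 i (Finset.mem_Icc.1 hi).1).integrable (by norm_num)]
  exact Finset.sum_eq_zero fun i hi => hmean i (Finset.mem_Icc.1 hi).1

lemma integral_normSum (hmean : ∀ n, 1 ≤ n → ∫ ω, X n ω ∂P = 0)
    (hX4 : ∀ n, 1 ≤ n → MemLp (X n) 4 P) (n : ℕ) : ∫ ω, normSum P X n ω ∂P = 0 := by
  simp only [normSum]
  rw [integral_div, integral_sum_eq_zero hmean hX4, zero_div]

lemma integral_normSum_sq (hmean : ∀ n, 1 ≤ n → ∫ ω, X n ω ∂P = 0)
    (hX4 : ∀ n, 1 ≤ n → MemLp (X n) 4 P) {n : ℕ} (hσ : 0 < sigma P X n) :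
    ∫ ω, normSum P X n ω ^ 2 ∂P = 1 := by
  have hm := memLp_finsetSum (Finset.Icc 1 n) fun i hi => hX4 i (Finset.mem_Icc.1 hi).1
  have hv : sigma P X n ^ 2 = ∫ ω, (∑ i ∈ Finset.Icc 1 n, X i ω) ^ 2 ∂P := by
    rw [sigma, Real.sq_sqrt (variance_nonneg _ _),
      variance_of_integral_eq_zero hm.1.aemeasurable (integral_sum_eq_zero hmean hX4 n)]
  simp only [normSum, div_pow]
  rw [integral_div, ← hv, div_self (by positivity)]

-- For `n ≥ 2` one has `2 u ≤ n`, so the truncated subtraction in `gapLen` is exact and `u + t + u =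
-- n`. At `n = 1` the default values give two terms instead of one.
omit [IsProbabilityMeasure P] in
lemma normSum_eq (hκ : IsGapSequence κ) {n : ℕ} (hn : 2 ≤ n)
    (hσ : 0 < sigma P X (halfLen κ n)) (ω : Ω) :
    normSum P X n ω = sigma P X (halfLen κ n) / sigma P X n *
      (normSum P X (halfLen κ n) ω + middleBlock P X κ n ω + lastBlock P X κ n ω) := by
  have hle := (halfLen_mem hκ hn).2
  have hsum : ∑ i ∈ Finset.Icc 1 n, X i ω = (∑ i ∈ Finset.Icc 1 (halfLen κ n), X i ω) +
      (∑ i ∈ Finset.Ioc (halfLen κ n) (halfLen κ n + gapLen κ n), X i ω) +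
      ∑ i ∈ Finset.Ioc (halfLen κ n + gapLen κ n) (halfLen κ n + gapLen κ n + halfLen κ n),
        X i ω := by
    have hI : ∀ m, Finset.Icc 1 m = Finset.Ioc 0 m := fun m => by ext; simp; omega
    rw [hI, hI, Finset.sum_Ioc_consecutive _ (Nat.zero_le _) (by omega),
      Finset.sum_Ioc_consecutive _ (Nat.zero_le _) (by omega)]
    congr 2
    rw [gapLen]
    omega
  rw [normSum, hsum, normSum, middleBlock, lastBlock]
  field_simp

/-- The perturbations added to the outer blocks are taken back from the middle one, so the
decomposition remains exact and its remainder is still small in `L⁴`. -/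
lemma momentSplitting_blocks (hmean : ∀ n, 1 ≤ n → ∫ ω, X n ω ∂P = 0)
    (hsigma : ∀ n, 1 ≤ n → 0 < sigma P X n) (hκ : IsGapSequence κ)
    (hX4 : ∀ n, 1 ≤ n → MemLp (X n) 4 P)
    (hξ4 : Tendsto (fun n => ∫ ω, middleBlock P X κ n ω ^ 4 ∂P) atTop (𝓝 0))
    {δ δ' : ℕ → Ω → ℝ} (hδ : IsMomentPerturbation P 4 δ δ') (hmS : HmS P X κ 4 δ δ')
    (hmI : HmI P X κ 4 δ δ') :
    MomentSplitting P (normSum P X) (halfLen κ)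
      (fun n => sigma P X (halfLen κ n) / sigma P X n) δ
      (fun n ω => lastBlock P X κ n ω + δ' n ω)
      (fun n ω => middleBlock P X κ n ω + (-δ n ω + -δ' n ω)) := by
  have m1 : ∀ n, MemLp (δ n) 4 P := fun n => by simpa using hδ.memLp n
  have m2 : ∀ n, MemLp (δ' n) 4 P := fun n => by simpa using hδ.memLp' n
  have m1n : ∀ n, MemLp (fun ω => -δ n ω) 4 P := fun n => (m1 n).neg
  have m2n : ∀ n, MemLp (fun ω => -δ' n ω) 4 P := fun n => (m2 n).neg
  have m12 : ∀ n, MemLp (fun ω => -δ n ω + -δ' n ω) 4 P := fun n => (m1n n).add (m2n n)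
  -- Fourth powers are nonnegative, so the sum of the two moments tends to `0` only if each does.
  obtain ⟨t1, t2⟩ := tendsto_zero_of_add (fun n => integral_nonneg fun ω => by positivity)
    (fun n => integral_nonneg fun ω => by positivity)
    (hδ.tendsto 4 (by norm_num) (by norm_num))
  have even4 : ∀ x : ℝ, (-x) ^ 4 = x ^ 4 := fun x => by ring
  exact
    { memS := memLp_normSum hX4
      memδ := m1
      memY' := fun n => (memLp_lastBlock hX4 n).add (m2 n)
      memζ := fun n => (memLp_middleBlock hX4 n).add (m12 n)
      mean := fun n _ => integral_normSum hmean hX4 n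
      sq := fun n hn => integral_normSum_sq hmean hX4 (hsigma n hn)
      one_le := one_le_halfLen hκ
      lt := (eventually_ge_atTop 2).mono fun n hn => halfLen_lt hκ hn
      tendsto_u := tendsto_halfLen κ
      r_nonneg := fun n => div_nonneg (Real.sqrt_nonneg _) (Real.sqrt_nonneg _)
      eq := (eventually_ge_atTop 2).mono fun n hn ω => by
        rw [normSum_eq hκ hn (hsigma _ (one_le_halfLen hκ n))]
        ring
      tendsto_δ := t1
      tendsto_ζ := tendsto_integral_add_pow_four (memLp_middleBlock hX4) m12 hξ4
        (tendsto_integral_add_pow_four m1n m2n (by simpa only [even4] using t1)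
          (by simpa only [even4] using t2))
      moment := fun p hp => hmS p (by omega)
      mixed := fun p q hp hq hpq => hmI p q hp hq (by omega) }

end

end BlockCLT

/-! ### The theorem -/

open BlockCLT in
theorem mainTheorem5 {Ω : Type*} [MeasurableSpace Ω] (P : Measure Ω) [IsProbabilityMeasure P]
    (X : ℕ → Ω → ℝ) (κ : ℕ → ℕ)
    (hmean : ∀ n, 1 ≤ n → ∫ ω, X n ω ∂P = 0)
    (hpos : ∀ n, 1 ≤ n → 0 < ∫ ω, X n ω ^ 2 ∂P)
    (hsigma : ∀ n, 1 ≤ n → 0 < BlockCLT.sigma P X n)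
    (hκ : BlockCLT.IsGapSequence κ)
    (hX4 : ∀ n, 1 ≤ n → MemLp (X n) 4 P)
    (hξ4 : Tendsto (fun n => ∫ ω, BlockCLT.middleBlock P X κ n ω ^ 4 ∂P) atTop (𝓝 0))
    (hSI : ∃ ε ε' : ℕ → Ω → ℝ, BlockCLT.IsL2Perturbation P ε ε' ∧
      BlockCLT.HS P X κ ε ε' ∧ BlockCLT.HI P X κ ε ε')
    (hm : ∃ δ δ' : ℕ → Ω → ℝ, BlockCLT.IsMomentPerturbation P 4 δ δ' ∧
      BlockCLT.HmS P X κ 4 δ δ' ∧ BlockCLT.HmI P X κ 4 δ δ') :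
    TendstoInDistribution (fun n => BlockCLT.normSum P X n) atTop (id : ℝ → ℝ)
        (fun _ => P) (gaussianReal 0 1) ∧
      Tendsto (fun n => ∫ ω, BlockCLT.normSum P X n ω ^ 3 ∂P) atTop (𝓝 0) ∧
      Tendsto (fun n => ∫ ω, BlockCLT.normSum P X n ω ^ 4 ∂P) atTop (𝓝 3) := by
  obtain ⟨ε, ε', hε, hS, hI⟩ := hSI
  obtain ⟨δ, δ', hδ, hmS, hmI⟩ := hm
  have h := momentSplitting_blocks hmean hsigma hκ hX4 hξ4 hδ hmS hmI
  refine ⟨?_, h.tendsto_integral_pow_three, h.tendsto_integral_pow_four⟩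
  obtain ⟨B, hB⟩ := h.exists_forall_integral_pow_four_le
  refine tendstoInDistribution_gaussian_of_exp (fun n => (h.memS n).1.aemeasurable) fun t =>
    tendsto_integral_exp_of_recursion h.memS h.mean h.sq hB h.tendsto_u (fun t => ?_) t
  have h2 : ∀ {f : Ω → ℝ}, MemLp f 4 P → MemLp f 2 P := fun hf => hf.mono_exponent (by norm_num)
  have m2 : ∀ n, MemLp (fun ω => -δ' n ω) 4 P := fun n =>
    MemLp.neg (by simpa using hδ.memLp' n)
  have hδ4 : Tendsto (fun n => ∫ ω, (-δ' n ω) ^ 4 ∂P) atTop (𝓝 0) := by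
    have := (tendsto_zero_of_add (fun n => integral_nonneg fun ω => by positivity)
      (fun n => integral_nonneg fun ω => by positivity)
      (hδ.tendsto 4 (by norm_num) (by norm_num))).2
    simpa only [show ∀ x : ℝ, (-x) ^ 4 = x ^ 4 from fun x => by ring] using this
  -- The last block inherits a second moment bound from `S'_u + δ'`: eventually at most `2` there,
  -- and at most `1` more after removing `δ'`. The cell argument with `ε, ε'` thus rests on the
  -- moment conditions with `δ, δ'`.
  have hlast : ∀ᶠ n in atTop, ∫ ω, lastBlock P X κ n ω ^ 2 ∂P ≤ 3 := by
    have hY2 := h.tendsto_second'.eventually_le_const (show (1 : ℝ) < 2 by norm_num)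
    filter_upwards [hY2, (tendsto_integral_add_sq_sub (fun n => h2 (h.memY' n))
      (fun n => h2 (m2 n)) hY2 (tendsto_integral_pow_of_four (by norm_num) (by norm_num) m2
        hδ4)).eventually_le_const one_pos] with n h3 h4
    simp only [add_neg_cancel_right] at h4
    linarith
  obtain ⟨hε0, hε0'⟩ := tendsto_zero_of_add (fun n => integral_nonneg fun ω => sq_nonneg _)
    (fun n => integral_nonneg fun ω => sq_nonneg _) hε.tendsto
  exact tendsto_integral_exp_sub_sq_of_cells (fun n => h2 (h.memS n))
    (fun n => h2 (memLp_lastBlock hX4 n)) (fun n => h2 (memLp_middleBlock hX4 n)) hε.memLp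
    hε.memLp' (fun n => h.sq _ (h.one_le n)) hlast
    (tendsto_integral_pow_of_four (by norm_num) (by norm_num) (memLp_middleBlock hX4) hξ4)
    hε0 hε0' h.tendsto_r
    ((eventually_ge_atTop 2).mono fun n hn ω => normSum_eq hκ hn (hsigma _ (h.one_le n)) ω)
    (c := fun n => (sigmaStar P X κ ε n)⁻¹) (fun n => rfl) hS hI t
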